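/- For $d,k\ge1$ and $\delta>0$ let $m_0(d,k,\delta)$ be the smallest integer $m\ge1$ with $\left(\frac{ke}{m+1}\right)^{m+1}\le\frac{\delta}{2d2^k}$. Let $\mathbb S^d\subset\mathbb R^{d+1}$ be the unit sphere and $\sigma_d$ the $d$-dimensional area measure (the $d$-dimensional Hausdorff measure, normalized to agree with Lebesgue measure on $\mathbb R^d$). For a multi-index $\alpha\in(\mathbb N\cup\{0\})^{d+1}$ write $x^\alpha=\prod_q x_q^{\alpha_q}$ and $|\alpha|=\sum_q\alpha_q$. **Theorem 1.13.** For each $d\ge1$ there exist $C(d),c(d)>0$, depending only on $d$, such that the following holds. For each $0<\tau<1$ there is an integer $K=K(\tau,d)>0$ such that for all integers $k\ge1$ and all $0<\delta<1$ there is a partition of $\mathbb S^d$, up to $\sigma_d$-measure $0$, into Borel measurable subsets $E_1,\dots,E_K$ (that is, $\sigma_d(E_i\cap E_j)=0$ for $i\ne j$ and $\sigma_d(\mathbb S^d\setminus\bigcup_iE_i)=0$) satisfying: 1. $\operatorname{diam}(E_i)\le C(d)\tau$ and $c(d)\tau^d\le\sigma_d(E_i)<\infty$ for all $i$, and $K\le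 C(d)\tau^{-d}$. 2. For every integer $n\ge C(d)^{m_0(d,k,\delta)}$, with $N=n^d$, and for each $1\le i\le K$, there exist (not necessarily distinct) points $z_{i,1},\dots,z_{i,N}\in E_i$ such that $$\left|\frac1N\sum_{j=1}^N(z_{i,j}-w)^\alpha-\frac1{\sigma_d(E_i)}\int_{E_i}(z-w)^\alpha\,d\sigma_d(z)\right|\le\delta$$ for all $w\in\mathbb S^d$ and all multi-indices $\alpha$ with $|\alpha|\le k$. -/

import Mathlib

open MeasureTheory

noncomputable section

/-- The unit sphere `𝕊^d` embedded in `ℝ^(d+1)`. -/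
def unitSphere (d : ℕ) : Set (EuclideanSpace ℝ (Fin (d + 1))) :=
  Metric.sphere 0 1

/-- The `d`-dimensional area measure `σ_d` on sets in `ℝ^(d+1)`: the `d`-dimensional Hausdorff
measure, normalized to agree with Lebesgue measure on `ℝ^d`. -/
def areaMeasure (d : ℕ) : Measure (EuclideanSpace ℝ (Fin (d + 1))) :=
  μHE[d]

/-- The monomial `x^α = ∏ q, x_q ^ α_q` for a multi-index `α`. -/
def monomialAt {ι : Type*} [Fintype ι] (α : ι → ℕ) (x : EuclideanSpace ℝ ι) : ℝ :=
  ∏ q, x q ^ α q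

/-- The smallest integer `m ≥ 1` with `(k e / (m + 1)) ^ (m + 1) ≤ δ / (2 d 2^k)`. -/
def mZero (d k : ℕ) (δ : ℝ) : ℕ :=
  sInf {m : ℕ | 1 ≤ m ∧
    ((k : ℝ) * Real.exp 1 / ((m : ℝ) + 1)) ^ (m + 1) ≤ δ / (2 * (d : ℝ) * 2 ^ k)}

/-- The set of which `mZero d k δ` is the infimum is non-empty, so that `mZero d k δ` is
its least element. -/
theorem mZero_isLeast (d k : ℕ) (δ : ℝ) (hd : 1 ≤ d) (hδ : 0 < δ) :
    IsLeast {m : ℕ | 1 ≤ m ∧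
      ((k : ℝ) * Real.exp 1 / ((m : ℝ) + 1)) ^ (m + 1) ≤ δ / (2 * (d : ℝ) * 2 ^ k)}
      (mZero d k δ) := by
  have hd' : (0 : ℝ) < d := by exact_mod_cast hd
  have hε : 0 < δ / (2 * (d : ℝ) * 2 ^ k) := by positivity
  obtain ⟨p, hp⟩ := exists_pow_lt_of_lt_one hε (show (1 / 2 : ℝ) < 1 by norm_num)
  obtain ⟨q, hq⟩ := exists_nat_ge (2 * ((k : ℝ) * Real.exp 1))
  refine ⟨Nat.sInf_mem ⟨p + q + 1, by omega, ?_⟩, fun m hm => Nat.sInf_le hm⟩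
  have hp0 : (0 : ℝ) ≤ p := p.cast_nonneg
  have hq0 : (0 : ℝ) ≤ q := q.cast_nonneg
  have h1 : (k : ℝ) * Real.exp 1 / (((p + q + 1 : ℕ) : ℝ) + 1) ≤ 1 / 2 := by
    push_cast
    rw [div_le_iff₀ (by linarith)]
    linarith
  calc _ ≤ (1 / 2 : ℝ) ^ (p + q + 1 + 1) := pow_le_pow_left₀ (by positivity) h1 _
    _ ≤ (1 / 2 : ℝ) ^ p := pow_le_pow_of_le_one (by norm_num) (by norm_num) (by omega)
    _ ≤ _ := hp.le

end

noncomputable section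

/-! The quadratures can be made exact: on each cell, `n ^ d` equally weighted nodes integrate every
polynomial of degree at most `k` without error as soon as `n` exceeds a fixed base to the power `k`.
Since `k ≤ mZero d k δ` (`le_mZero`), the assumed size of `n` suffices, and `δ` plays no further
role.

The cells are central projections of grid cubes on the faces of `[-1, 1] ^ (d + 1)`. In this
gnomonic chart, area is comparable to Lebesgue measure on boxes (`boxComparable_chartMeasure`), and
polynomials become polynomials in the coordinates of the projected point (`sphericalPoly`).

For exactness (`exists_equal_weight_quadrature`), cut the cube into `n ^ d` boxes of equal mass and
choose one node in each, minimising the sum of squares of the errors `e f` over a finite spanning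
set of test functions. Put `p = ∑ e f • f`. By minimality the differential of `p` at each node is
nonnegative in all directions into its box, so the box average of `p` exceeds the value at the node
by a first order amount, up to a Taylor remainder. A Markov inequality (`abs_partialDeriv_le`)
bounds second derivatives by first ones and makes the remainders negligible for large `n`. Hence the
node average of `p` is at most its mean. But the difference of the two is `∑ e f ^ 2`, so every
error vanishes.

The Markov inequality reduces to one variable: along a line parallel to an axis, the half-angle
substitution turns a spherical polynomial into a polynomial of degree `2 * k` over `(1 + s ^ 2) ^
k`. -/

/-- The last coordinate of the central projection of `(y, 1)` to the unit sphere. -/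
def gnomonicHeight {d : ℕ} (y : Fin d → ℝ) : ℝ := (√(1 + ∑ i, y i ^ 2))⁻¹

/-- The constant `1` and the coordinates of the central projection of `(y, 1)` to the sphere. -/
def gnomonicCoords (d : ℕ) : Set ((Fin d → ℝ) → ℝ) :=
  {1, gnomonicHeight} ∪ Set.range fun (j : Fin d) y => y j * gnomonicHeight y

/-- Polynomials of degree at most `k` on the sphere, read in the gnomonic chart. -/
def sphericalPoly (d k : ℕ) : Submodule ℝ ((Fin d → ℝ) → ℝ) :=
  Submodule.span ℝ (gnomonicCoords d) ^ k

/-- The `j`-th partial derivative. -/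
def partialDeriv {d : ℕ} (j : Fin d) (g : (Fin d → ℝ) → ℝ) (y : Fin d → ℝ) : ℝ :=
  fderiv ℝ g y (Pi.single j 1)

/-! ### Spherical polynomials in the gnomonic chart and their derivatives -/

section sphericalPoly

variable {d : ℕ}

theorem one_add_sum_sq_pos (y : Fin d → ℝ) : 0 < 1 + ∑ i, y i ^ 2 := by
  have : 0 ≤ ∑ i, y i ^ 2 := Finset.sum_nonneg fun i _ => sq_nonneg _
  linarith

theorem gnomonicHeight_pos (y : Fin d → ℝ) : 0 < gnomonicHeight y :=
  inv_pos.2 (Real.sqrt_pos.2 (one_add_sum_sq_pos y))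

theorem sphericalPoly_fg (k : ℕ) : (sphericalPoly d k).FG := by
  refine Submodule.FG.pow (Submodule.fg_span ?_) k
  exact ((Set.toFinite {1, gnomonicHeight}).union (Set.finite_range _))

theorem one_mem_sphericalPoly_one : (1 : (Fin d → ℝ) → ℝ) ∈ sphericalPoly d 1 := by
  rw [sphericalPoly, pow_one]
  exact Submodule.subset_span (by simp [gnomonicCoords])

theorem gnomonicHeight_mem : (gnomonicHeight : (Fin d → ℝ) → ℝ) ∈ sphericalPoly d 1 := by
  rw [sphericalPoly, pow_one]
  exact Submodule.subset_span (by simp [gnomonicCoords])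

theorem coord_mul_gnomonicHeight_mem (j : Fin d) :
    (fun y : Fin d → ℝ => y j * gnomonicHeight y) ∈ sphericalPoly d 1 := by
  rw [sphericalPoly, pow_one]
  exact Submodule.subset_span (Or.inr ⟨j, rfl⟩)

theorem mul_mem_sphericalPoly {a b : ℕ} {f g : (Fin d → ℝ) → ℝ} (hf : f ∈ sphericalPoly d a)
    (hg : g ∈ sphericalPoly d b) : f * g ∈ sphericalPoly d (a + b) := by
  rw [sphericalPoly, pow_add]
  exact Submodule.mul_mem_mul hf hg

theorem one_mem_sphericalPoly (k : ℕ) : (1 : (Fin d → ℝ) → ℝ) ∈ sphericalPoly d k := by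
  induction k with
  | zero => rw [sphericalPoly, pow_zero]; exact Submodule.one_le.1 le_rfl
  | succ k ih => simpa using mul_mem_sphericalPoly ih one_mem_sphericalPoly_one

theorem sphericalPoly_mono {a b : ℕ} (h : a ≤ b) : sphericalPoly d a ≤ sphericalPoly d b := by
  obtain ⟨c, rfl⟩ := Nat.exists_eq_add_of_le h
  intro f hf
  simpa using mul_mem_sphericalPoly hf (one_mem_sphericalPoly c)

theorem prod_pow_mem_sphericalPoly {ι : Type*} (s : Finset ι) (f : ι → (Fin d → ℝ) → ℝ)
    (hf : ∀ q, f q ∈ sphericalPoly d 1) (α : ι → ℕ) :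
    (∏ q ∈ s, f q ^ α q) ∈ sphericalPoly d (∑ q ∈ s, α q) := by
  classical
  induction s using Finset.induction_on with
  | empty => simpa using one_mem_sphericalPoly 0
  | insert a s ha ih =>
    rw [Finset.prod_insert ha, Finset.sum_insert ha]
    refine mul_mem_sphericalPoly ?_ ih
    have := Submodule.pow_mem_pow _ (hf a) (α a)
    rwa [sphericalPoly, pow_one] at this

theorem hasFDerivAt_gnomonicHeight (y : Fin d → ℝ) :
    HasFDerivAt gnomonicHeight
      (∑ i, (-(y i * gnomonicHeight y ^ 3)) • ContinuousLinearMap.proj (R := ℝ)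
        (φ := fun _ : Fin d => ℝ) i) y := by
  have hpos := one_add_sum_sq_pos y
  have h1 : HasFDerivAt (fun z : Fin d → ℝ => 1 + ∑ i, z i ^ 2)
      (∑ i, (2 * y i) • ContinuousLinearMap.proj (R := ℝ) (φ := fun _ : Fin d => ℝ) i) y := by
    refine HasFDerivAt.const_add _ (HasFDerivAt.fun_sum fun i _ => ?_)
    simpa using (hasFDerivAt_apply (𝕜 := ℝ) i y).pow 2
  have h2 := (hasDerivAt_inv (Real.sqrt_pos.2 hpos).ne').comp_hasFDerivAt y (h1.sqrt hpos.ne')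
  refine h2.congr_fderiv ?_
  simp only [Finset.smul_sum, smul_smul]
  refine Finset.sum_congr rfl fun i _ => ?_
  congr 1
  have : √(1 + ∑ i, y i ^ 2) ≠ 0 := (Real.sqrt_pos.2 hpos).ne'
  simp only [gnomonicHeight]
  field_simp

theorem partialDeriv_gnomonicHeight (j : Fin d) (y : Fin d → ℝ) :
    partialDeriv j gnomonicHeight y = -(y j * gnomonicHeight y ^ 3) := by
  rw [partialDeriv, (hasFDerivAt_gnomonicHeight y).fderiv]
  simp [Pi.single_apply]

theorem differentiable_gnomonicHeight :
    Differentiable ℝ (gnomonicHeight : (Fin d → ℝ) → ℝ) :=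
  fun y => (hasFDerivAt_gnomonicHeight y).differentiableAt

theorem partialDeriv_add {f g : (Fin d → ℝ) → ℝ} (hf : Differentiable ℝ f)
    (hg : Differentiable ℝ g) (j : Fin d) :
    partialDeriv j (f + g) = partialDeriv j f + partialDeriv j g := by
  funext y
  simp [partialDeriv, fderiv_add (hf y) (hg y)]

theorem partialDeriv_smul {f : (Fin d → ℝ) → ℝ} (hf : Differentiable ℝ f) (c : ℝ) (j : Fin d) :
    partialDeriv j (c • f) = c • partialDeriv j f := by
  funext y
  simp [partialDeriv, fderiv_const_smul (hf y) c]

theorem partialDeriv_mul {f g : (Fin d → ℝ) → ℝ} (hf : Differentiable ℝ f)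
    (hg : Differentiable ℝ g) (j : Fin d) :
    partialDeriv j (f * g) = f * partialDeriv j g + g * partialDeriv j f := by
  funext y
  simp [partialDeriv, fderiv_mul (hf y) (hg y)]

/-- With `ρ` the height, `∂ⱼρ = -(yⱼρ)ρρ` is again a product of generators, of degree three; the
product rule then handles `yᵢρ`. -/
theorem differentiable_and_partialDeriv_mem_of_mem_span {f : (Fin d → ℝ) → ℝ}
    (hf : f ∈ Submodule.span ℝ (gnomonicCoords d)) :
    Differentiable ℝ f ∧ ∀ j, partialDeriv j f ∈ sphericalPoly d 3 := by
  induction hf using Submodule.span_induction with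
  | zero =>
    refine ⟨differentiable_const _, fun j => ?_⟩
    have : partialDeriv j (0 : (Fin d → ℝ) → ℝ) = 0 := by
      funext y; simp [partialDeriv]
    rw [this]; exact Submodule.zero_mem _
  | add f g _ _ hf hg =>
    refine ⟨hf.1.add hg.1, fun j => ?_⟩
    rw [partialDeriv_add hf.1 hg.1]
    exact Submodule.add_mem _ (hf.2 j) (hg.2 j)
  | smul c f _ hf =>
    refine ⟨hf.1.const_smul c, fun j => ?_⟩
    rw [partialDeriv_smul hf.1]
    exact Submodule.smul_mem _ _ (hf.2 j)
  | mem f hf =>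
    have hρ := gnomonicHeight_mem (d := d)
    rcases hf with (rfl | rfl) | ⟨i, rfl⟩
    · refine ⟨differentiable_const _, fun j => ?_⟩
      have : partialDeriv j (1 : (Fin d → ℝ) → ℝ) = 0 := by
        funext y; simp [partialDeriv, show (1 : (Fin d → ℝ) → ℝ) = fun _ => 1 from rfl]
      rw [this]; exact Submodule.zero_mem _
    · refine ⟨differentiable_gnomonicHeight, fun j => ?_⟩
      have : partialDeriv j gnomonicHeight = (-1 : ℝ) •
          ((fun y : Fin d → ℝ => y j * gnomonicHeight y) * gnomonicHeight * gnomonicHeight) := by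
        funext y
        rw [partialDeriv_gnomonicHeight]
        simp only [Pi.smul_apply, Pi.mul_apply, smul_eq_mul]
        ring
      rw [this]
      exact Submodule.smul_mem _ _ (mul_mem_sphericalPoly
        (mul_mem_sphericalPoly (coord_mul_gnomonicHeight_mem j) hρ) hρ)
    · have hd : Differentiable ℝ (fun y : Fin d → ℝ => y i) := differentiable_apply i
      refine ⟨hd.mul differentiable_gnomonicHeight, fun j => ?_⟩
      have : partialDeriv j (fun y : Fin d → ℝ => y i * gnomonicHeight y) =
          (if i = j then (1 : ℝ) else 0) • gnomonicHeight + (-1 : ℝ) •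
          ((fun y : Fin d → ℝ => y i * gnomonicHeight y) *
            (fun y : Fin d → ℝ => y j * gnomonicHeight y) * gnomonicHeight) := by
        have h := partialDeriv_mul hd differentiable_gnomonicHeight j
        have e : (fun y : Fin d → ℝ => y i * gnomonicHeight y) =
          (fun y : Fin d → ℝ => y i) * gnomonicHeight := rfl
        rw [e, h]
        funext y
        have h2 : partialDeriv j (fun y : Fin d → ℝ => y i) y = if i = j then (1 : ℝ) else 0 := by
          rw [partialDeriv, (hasFDerivAt_apply (𝕜 := ℝ) i y).fderiv]
          simp [Pi.single_apply]
        simp only [Pi.add_apply, Pi.mul_apply, Pi.smul_apply, smul_eq_mul, h2,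
          partialDeriv_gnomonicHeight]
        ring
      rw [this]
      refine Submodule.add_mem _ (Submodule.smul_mem _ _ (sphericalPoly_mono (by norm_num) hρ))
        (Submodule.smul_mem _ _ (mul_mem_sphericalPoly (mul_mem_sphericalPoly
          (coord_mul_gnomonicHeight_mem i) (coord_mul_gnomonicHeight_mem j)) hρ))

/-- By Leibniz only one factor is differentiated at a time, and this trades degree one for degree
three; so the degree grows by two whatever `k` is. This closure lets the Markov inequality be
applied to derivatives. -/
theorem differentiable_and_partialDeriv_mem {k : ℕ} {f : (Fin d → ℝ) → ℝ}
    (hf : f ∈ sphericalPoly d k) :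
    Differentiable ℝ f ∧ ∀ j, partialDeriv j f ∈ sphericalPoly d (k + 2) := by
  refine Submodule.pow_induction_on_left' (Submodule.span ℝ (gnomonicCoords d))
    (C := fun n x _ => Differentiable ℝ x ∧ ∀ j, partialDeriv j x ∈ sphericalPoly d (n + 2))
    ?_ ?_ ?_ hf
  · intro r
    refine ⟨differentiable_const _, fun j => ?_⟩
    have : partialDeriv j (algebraMap ℝ ((Fin d → ℝ) → ℝ) r) = 0 := by
      funext y
      simp [partialDeriv, show algebraMap ℝ ((Fin d → ℝ) → ℝ) r = fun _ => r from rfl]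
    rw [this]; exact Submodule.zero_mem _
  · intro f g n _ _ hf hg
    refine ⟨hf.1.add hg.1, fun j => ?_⟩
    rw [partialDeriv_add hf.1 hg.1]
    exact Submodule.add_mem _ (hf.2 j) (hg.2 j)
  · intro m hm n f hf' hf
    have hm' := differentiable_and_partialDeriv_mem_of_mem_span hm
    refine ⟨hm'.1.mul hf.1, fun j => ?_⟩
    rw [partialDeriv_mul hm'.1 hf.1]
    refine Submodule.add_mem _ ?_ ?_
    · have h1 : m ∈ sphericalPoly d 1 := by rwa [sphericalPoly, pow_one]
      have := mul_mem_sphericalPoly h1 (hf.2 j)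
      exact sphericalPoly_mono (by omega) this
    · exact sphericalPoly_mono (by omega) 
        (mul_mem_sphericalPoly (show f ∈ sphericalPoly d n from hf') (hm'.2 j))

end sphericalPoly

/-! ### Markov's inequality in one variable -/

open Polynomial in
/-- Markov's inequality at the endpoint `c` of an interval with centre `c - l`. -/
theorem mul_derivative_eval_le_of_abs_le {n : ℕ} {P : ℝ[X]} (hP : P.natDegree ≤ n) {c l G : ℝ}
    (hG : 0 < G) (h : ∀ u ∈ Set.Icc (-1 : ℝ) 1, |P.eval (c - l + l * u)| ≤ G) :
    l * P.derivative.eval c ≤ n ^ 2 * G := by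
  -- The affine change of variable sends `1` to `c`, where the Chebyshev polynomial is extremal with
  -- derivative `n ^ 2`. The sign of `l` is free, so `c` may be either endpoint.
  set R : ℝ[X] := C G⁻¹ * P.comp (C (c - l) + C l * X) with hR
  have hdeg : R.degree ≤ n := by
    refine natDegree_le_iff_degree_le.1 ?_
    refine (natDegree_C_mul_le _ _).trans (natDegree_comp_le.trans ?_)
    have : (C (c - l) + C l * X : ℝ[X]).natDegree ≤ 1 := by compute_degree
    calc _ ≤ n * 1 := Nat.mul_le_mul hP this
      _ = n := mul_one _
  have hev : ∀ u, R.eval u = G⁻¹ * P.eval (c - l + l * u) := by intro u; simp [hR]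
  have := Chebyshev.eval_iterate_derivative_le_of_forall_abs_le_one (k := 1) (x := 1) le_rfl hdeg
    (fun u hu => by
      rw [hev, abs_mul, abs_of_pos (inv_pos.2 hG), inv_mul_le_iff₀ hG]
      linarith [h u hu])
  simp only [Function.iterate_one, Chebyshev.derivative_T_eval_one] at this
  have hd : R.derivative.eval 1 = G⁻¹ * (l * P.derivative.eval c) := by
    simp [hR, derivative_comp]
  rw [hd, inv_mul_le_iff₀ hG] at this
  push_cast at this
  linarith

open Polynomial in
/-- A form of Markov's inequality. -/
theorem abs_derivative_eval_le_of_abs_le {n : ℕ} {P : ℝ[X]} (hP : P.natDegree ≤ n) {a b G : ℝ}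
    (hab : a < b) (hG : ∀ x ∈ Set.Icc a b, |P.eval x| ≤ G) {x : ℝ} (hx : x ∈ Set.Icc a b) :
    |P.derivative.eval x| ≤ 4 * n ^ 2 / (b - a) * G := by
  have hG0 : 0 ≤ G := (abs_nonneg _).trans (hG x hx)
  have hba : 0 < b - a := sub_pos.2 hab
  -- Take the interval from `x` to the farther of `a` and `b`: it has `x` as an endpoint and
  -- half-length at least `(b - a) / 4`.
  obtain ⟨l, hl, hm⟩ : ∃ l : ℝ, (b - a) / 4 ≤ |l| ∧
      ∀ u ∈ Set.Icc (-1 : ℝ) 1, x - l + l * u ∈ Set.Icc a b := by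
    rcases le_total (x - a) (b - x) with h | h
    · refine ⟨-(b - x) / 2, ?_, ?_⟩
      · rw [abs_of_nonpos (by linarith)]; linarith
      · rintro u ⟨hu1, hu2⟩
        constructor <;> nlinarith [hx.1, hx.2]
    · refine ⟨(x - a) / 2, ?_, ?_⟩
      · rw [abs_of_nonneg (by linarith)]; linarith
      · rintro u ⟨hu1, hu2⟩
        constructor <;> nlinarith [hx.1, hx.2]
  -- The normalisation divides by the bound, which may be zero; hence the slack `η`, removed in the
  -- limit.
  have main : ∀ η > 0, |P.derivative.eval x| ≤ 4 * n ^ 2 / (b - a) * (G + η) := by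
    intro η hη
    have hGη : 0 < G + η := by linarith
    have hmG : ∀ u ∈ Set.Icc (-1 : ℝ) 1, |P.eval (x - l + l * u)| ≤ G + η := fun u hu => by
      linarith [hG _ (hm u hu)]
    have h1 := mul_derivative_eval_le_of_abs_le hP hGη hmG
    have hneg := mul_derivative_eval_le_of_abs_le (n := n) (P := -P) (by rwa [natDegree_neg]) hGη
      (by simpa using hmG)
    rw [derivative_neg, eval_neg] at hneg
    have h2 : |l| * |P.derivative.eval x| ≤ n ^ 2 * (G + η) := by
      rw [← abs_mul]; exact abs_le.2 ⟨by linarith, h1⟩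
    have h3 : (b - a) / 4 * |P.derivative.eval x| ≤ n ^ 2 * (G + η) :=
      (mul_le_mul_of_nonneg_right hl (abs_nonneg _)).trans h2
    rw [div_mul_eq_mul_div, le_div_iff₀ hba]
    linarith
  have hlim : Filter.Tendsto (fun η : ℝ => 4 * n ^ 2 / (b - a) * (G + η)) (nhdsWithin 0 (Set.Ioi 0))
      (nhds (4 * n ^ 2 / (b - a) * (G + 0))) := by
    refine Filter.Tendsto.mono_left ?_ nhdsWithin_le_nhds
    exact (continuous_const.mul (continuous_const.add continuous_id)).tendsto 0
  rw [add_zero] at hlim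
  exact ge_of_tendsto hlim (eventually_nhdsWithin_of_forall fun η hη => main η hη)

/-! ### The half-angle substitution -/

/-- The tangent of the half angle on the great circle over the line at distance `b` from the
centre. -/
def halfAngleTan (b t : ℝ) : ℝ := t / (b + √(b ^ 2 + t ^ 2))

theorem hasDerivAt_halfAngleTan {b : ℝ} (hb : 0 < b) (t : ℝ) :
    HasDerivAt (halfAngleTan b) (b / (√(b ^ 2 + t ^ 2) * (b + √(b ^ 2 + t ^ 2)))) t := by
  have hpos : 0 < b ^ 2 + t ^ 2 := by positivity
  have hw := Real.sqrt_pos.2 hpos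
  have h1 : HasDerivAt (fun t => b ^ 2 + t ^ 2) (2 * t) t := by
    simpa using (hasDerivAt_pow 2 t).const_add (b ^ 2)
  have h2 := (hasDerivAt_id t).div ((h1.sqrt hpos.ne').const_add b) (by positivity)
  refine h2.congr_deriv ?_
  have hsq := Real.sq_sqrt hpos.le
  set w := √(b ^ 2 + t ^ 2)
  simp only [id]
  field_simp
  linear_combination hsq

theorem halfAngleTan_sq_le_one {b : ℝ} (hb : 0 < b) (t : ℝ) : halfAngleTan b t ^ 2 ≤ 1 := by
  have hpos : 0 < b ^ 2 + t ^ 2 := by positivity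
  have hw := Real.sqrt_pos.2 hpos
  have hsq := Real.sq_sqrt hpos.le
  rw [halfAngleTan, div_pow, div_le_one (by positivity)]
  nlinarith

/-- For `t = b * tan θ` and `s = tan (θ / 2)` this is `cos θ = (1 - s ^ 2) / (1 + s ^ 2)`. -/
theorem inv_sqrt_eq_halfAngleTan {b : ℝ} (hb : 0 < b) (t : ℝ) :
    (√(b ^ 2 + t ^ 2))⁻¹ * (1 + halfAngleTan b t ^ 2) = b⁻¹ * (1 - halfAngleTan b t ^ 2) := by
  have hpos : 0 < b ^ 2 + t ^ 2 := by positivity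
  have hw := Real.sqrt_pos.2 hpos
  have hsq := Real.sq_sqrt hpos.le
  rw [halfAngleTan]
  set w := √(b ^ 2 + t ^ 2)
  field_simp
  linear_combination (-w - b) * hsq

/-- In the same notation, `sin θ = 2 * s / (1 + s ^ 2)`. -/
theorem mul_inv_sqrt_eq_halfAngleTan {b : ℝ} (hb : 0 < b) (t : ℝ) :
    t * (√(b ^ 2 + t ^ 2))⁻¹ * (1 + halfAngleTan b t ^ 2) = 2 * halfAngleTan b t := by
  have hpos : 0 < b ^ 2 + t ^ 2 := by positivity
  have hw := Real.sqrt_pos.2 hpos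
  have hsq := Real.sq_sqrt hpos.le
  rw [halfAngleTan]
  set w := √(b ^ 2 + t ^ 2)
  field_simp
  linear_combination (-t) * hsq

/-! ### Markov's inequality for spherical polynomials -/

section line

variable {d : ℕ}

/-- The distance from the centre to the line through `x` in the `j`-th direction. -/
def lineDist (x : Fin d → ℝ) (j : Fin d) : ℝ := √(1 + ∑ i ∈ Finset.univ.erase j, x i ^ 2)

theorem lineDist_sq (x : Fin d → ℝ) (j : Fin d) :
    lineDist x j ^ 2 = 1 + ∑ i ∈ Finset.univ.erase j, x i ^ 2 :=
  Real.sq_sqrt (add_nonneg zero_le_one (Finset.sum_nonneg fun _ _ => sq_nonneg _))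

theorem one_le_lineDist (x : Fin d → ℝ) (j : Fin d) : 1 ≤ lineDist x j := by
  have h : 0 ≤ ∑ i ∈ Finset.univ.erase j, x i ^ 2 := Finset.sum_nonneg fun _ _ => sq_nonneg _
  exact Real.one_le_sqrt.2 (by linarith)

theorem lineDist_sq_le (x : Fin d → ℝ) (hx : ∀ i, |x i| ≤ 1) (j : Fin d) :
    lineDist x j ^ 2 ≤ d := by
  rw [lineDist_sq]
  have h : ∑ i ∈ Finset.univ.erase j, x i ^ 2 ≤ ∑ i ∈ Finset.univ.erase j, (1 : ℝ) :=
    Finset.sum_le_sum fun i _ => (sq_le_one_iff_abs_le_one _).2 (hx i)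
  have hd : 0 < d := j.pos
  rw [Finset.sum_const, Finset.card_erase_of_mem (Finset.mem_univ j), Finset.card_univ,
    Fintype.card_fin, nsmul_eq_mul, mul_one, Nat.cast_sub (by omega)] at h
  push_cast at h
  linarith

theorem gnomonicHeight_update (x : Fin d → ℝ) (j : Fin d) (t : ℝ) :
    gnomonicHeight (Function.update x j t) = (√(lineDist x j ^ 2 + t ^ 2))⁻¹ := by
  rw [gnomonicHeight, lineDist_sq, ← Finset.sum_erase_add _ _ (Finset.mem_univ j)]
  simp only [Function.update_self]
  congr 2
  rw [← add_assoc]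
  congr 2
  refine Finset.sum_congr rfl fun i hi => ?_
  rw [Function.update_of_ne (Finset.ne_of_mem_erase hi)]

-- On the line, each generator is a constant multiple of `1`, `cos θ` or `sin θ`, so one factor `1 +
-- s ^ 2` clears its denominator.
open Polynomial in
theorem exists_polynomial_of_mem_span_gnomonicCoords {f : (Fin d → ℝ) → ℝ}
    (hf : f ∈ Submodule.span ℝ (gnomonicCoords d)) (x : Fin d → ℝ) (j : Fin d) :
    ∃ Q : ℝ[X], Q.natDegree ≤ 2 ∧ ∀ t, f (Function.update x j t) *
      (1 + halfAngleTan (lineDist x j) t ^ 2) = Q.eval (halfAngleTan (lineDist x j) t) := by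
  have hb : 0 < lineDist x j := zero_lt_one.trans_le (one_le_lineDist x j)
  induction hf using Submodule.span_induction with
  | zero => exact ⟨0, by simp, by simp⟩
  | add f g _ _ hf hg =>
    obtain ⟨P, hP, hP'⟩ := hf
    obtain ⟨Q, hQ, hQ'⟩ := hg
    refine ⟨P + Q, natDegree_add_le_of_degree_le hP hQ, fun t => ?_⟩
    rw [Pi.add_apply, add_mul, hP', hQ', eval_add]
  | smul c f _ hf =>
    obtain ⟨P, hP, hP'⟩ := hf
    refine ⟨C c * P, (natDegree_C_mul_le _ _).trans hP, fun t => ?_⟩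
    rw [Pi.smul_apply, smul_eq_mul, mul_assoc, hP', eval_mul, eval_C]
  | mem f hf =>
    rcases hf with (rfl | rfl) | ⟨i, rfl⟩
    · exact ⟨1 + X ^ 2, by compute_degree, fun t => by simp⟩
    · refine ⟨C (lineDist x j)⁻¹ * (1 - X ^ 2), ?_, fun t => ?_⟩
      · refine (natDegree_C_mul_le _ _).trans ?_
        compute_degree
      · rw [gnomonicHeight_update, inv_sqrt_eq_halfAngleTan hb]
        simp
    · rcases eq_or_ne i j with rfl | hij
      · refine ⟨C 2 * X, (natDegree_C_mul_le _ _).trans (natDegree_X_le.trans one_le_two),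
          fun t => ?_⟩
        simp only [Function.update_self]
        rw [gnomonicHeight_update, mul_inv_sqrt_eq_halfAngleTan hb]
        simp
      · refine ⟨C (x i) * (C (lineDist x j)⁻¹ * (1 - X ^ 2)), ?_, fun t => ?_⟩
        · refine (natDegree_C_mul_le _ _).trans ((natDegree_C_mul_le _ _).trans ?_)
          compute_degree
        · simp only [Function.update_of_ne hij]
          rw [gnomonicHeight_update, mul_assoc, inv_sqrt_eq_halfAngleTan hb]
          simp

open Polynomial in
theorem exists_polynomial_of_mem_sphericalPoly {k : ℕ} {f : (Fin d → ℝ) → ℝ}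
    (hf : f ∈ sphericalPoly d k) (x : Fin d → ℝ) (j : Fin d) :
    ∃ Q : ℝ[X], Q.natDegree ≤ 2 * k ∧ ∀ t, f (Function.update x j t) *
      (1 + halfAngleTan (lineDist x j) t ^ 2) ^ k = Q.eval (halfAngleTan (lineDist x j) t) := by
  refine Submodule.pow_induction_on_left' (Submodule.span ℝ (gnomonicCoords d))
    (C := fun n f _ => ∃ Q : ℝ[X], Q.natDegree ≤ 2 * n ∧ ∀ t, f (Function.update x j t) *
      (1 + halfAngleTan (lineDist x j) t ^ 2) ^ n = Q.eval (halfAngleTan (lineDist x j) t))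
    ?_ ?_ ?_ hf
  · exact fun r => ⟨C r, by simp, fun t => by simp⟩
  · rintro f g n _ _ ⟨P, hP, hP'⟩ ⟨Q, hQ, hQ'⟩
    refine ⟨P + Q, natDegree_add_le_of_degree_le hP hQ, fun t => ?_⟩
    rw [Pi.add_apply, add_mul, hP', hQ', eval_add]
  · rintro m hm n f _ ⟨Q, hQ, hQ'⟩
    obtain ⟨P, hP, hP'⟩ := exists_polynomial_of_mem_span_gnomonicCoords hm x j
    refine ⟨P * Q, ?_, fun t => ?_⟩
    · refine natDegree_mul_le.trans ?_
      rw [Nat.succ_eq_add_one]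
      omega
    · rw [eval_mul, ← hP', ← hQ', Pi.mul_apply, Nat.succ_eq_add_one]
      ring

theorem hasDerivAt_partialDeriv {f : (Fin d → ℝ) → ℝ} (hf : Differentiable ℝ f) (j : Fin d)
    (x : Fin d → ℝ) :
    HasDerivAt (fun t => f (Function.update x j t)) (partialDeriv j f x) (x j) := by
  have h1 := hasDerivAt_update x j (x j)
  have h2 : HasFDerivAt f (fderiv ℝ f x) (Function.update x j (x j)) := by
    rw [Function.update_eq_self]; exact (hf x).hasFDerivAt
  exact h2.comp_hasDerivAt (x j) h1

/-- Markov's inequality for spherical polynomials on a cube in the gnomonic chart. -/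
theorem abs_partialDeriv_le {k : ℕ} (hk : 1 ≤ k) {f : (Fin d → ℝ) → ℝ}
    (hf : f ∈ sphericalPoly d k) {a : Fin d → ℝ} {r G : ℝ} (hr : 0 < r)
    (hQ : Set.Icc a (fun i => a i + r) ⊆ Set.Icc (-1) 1)
    (hG : ∀ y ∈ Set.Icc a (fun i => a i + r), |f y| ≤ G) (j : Fin d) {x : Fin d → ℝ}
    (hx : x ∈ Set.Icc a (fun i => a i + r)) :
    |partialDeriv j f x| ≤ (1000 * d) ^ k / r * G := by
  have hd : 1 ≤ d := j.pos
  have hd' : (1 : ℝ) ≤ d := by exact_mod_cast hd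
  have hG0 : 0 ≤ G := (abs_nonneg _).trans (hG x hx)
  have hx1 : ∀ y ∈ Set.Icc a (fun i => a i + r), ∀ i, |y i| ≤ 1 := fun y hy i =>
    abs_le.2 ⟨(hQ hy).1 i, (hQ hy).2 i⟩
  obtain ⟨Q, hQd, hQe⟩ := exists_polynomial_of_mem_sphericalPoly hf x j
  set b := lineDist x j with hbdef
  have hb1 : 1 ≤ b := one_le_lineDist x j
  have hb : 0 < b := by linarith
  have hbd : b ^ 2 ≤ d := lineDist_sq_le x (hx1 x hx) j
  have hbd' : b ≤ d := by nlinarith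
  set s := halfAngleTan b with hs
  have hupd : ∀ t ∈ Set.Icc (a j) (a j + r),
      Function.update x j t ∈ Set.Icc a (fun i => a i + r) := by
    intro t ht
    constructor <;> intro i <;> rcases eq_or_ne i j with rfl | hij
    · simpa using ht.1
    · simpa [hij] using hx.1 i
    · simpa using ht.2
    · simpa [hij] using hx.2 i
  have ht1 : ∀ t ∈ Set.Icc (a j) (a j + r), |t| ≤ 1 := fun t ht => by
    simpa using hx1 _ (hupd t ht) j
  have hr2 : r ≤ 2 := by
    have h1 := abs_le.1 (ht1 (a j) ⟨le_rfl, by linarith⟩)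
    have h2 := abs_le.1 (ht1 (a j + r) ⟨by linarith, le_rfl⟩)
    linarith [h1.1, h2.2]
  -- bounds on the derivative of `s`
  have hder : ∀ t, HasDerivAt s (b / (√(b ^ 2 + t ^ 2) * (b + √(b ^ 2 + t ^ 2)))) t :=
    hasDerivAt_halfAngleTan hb
  have hw : ∀ t, b ≤ √(b ^ 2 + t ^ 2) := fun t => Real.le_sqrt_of_sq_le (by nlinarith [sq_nonneg t])
  have hder_pos : ∀ t, 0 ≤ b / (√(b ^ 2 + t ^ 2) * (b + √(b ^ 2 + t ^ 2))) := fun t => by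
    have := hw t
    positivity
  have hder_le : ∀ t, b / (√(b ^ 2 + t ^ 2) * (b + √(b ^ 2 + t ^ 2))) ≤ 1 := fun t => by
    have := hw t
    rw [div_le_one (by positivity)]
    nlinarith
  -- With `w` the square root, `b ≤ w` and `w ^ 2 ≤ d + 1 ≤ 2 * d` give `w * (b + w) ≤ 2 * w ^ 2 ≤ 4
  -- * d`, while `1 ≤ b`.
  have hder_ge : ∀ t ∈ Set.Icc (a j) (a j + r),
      1 / (4 * d) ≤ b / (√(b ^ 2 + t ^ 2) * (b + √(b ^ 2 + t ^ 2))) := fun t ht => by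
    have h1 := hw t
    have h2 := Real.sq_sqrt (show 0 ≤ b ^ 2 + t ^ 2 by positivity)
    have h3 := (sq_le_one_iff_abs_le_one _).2 (ht1 t ht)
    rw [div_le_div_iff₀ (by positivity) (by positivity)]
    nlinarith
  have hmono : Monotone s := by
    refine monotone_of_deriv_nonneg (fun t => (hder t).differentiableAt) fun t => ?_
    rw [(hder t).deriv]; exact hder_pos t
  have hcont : Continuous s := continuous_iff_continuousAt.2 fun t => (hder t).continuousAt
  have hlen : r / (4 * d) ≤ s (a j + r) - s (a j) := by
    have := (convex_Icc (a j) (a j + r)).mul_sub_le_image_sub_of_le_deriv (f := s)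
      (C := 1 / (4 * d)) hcont.continuousOn
      (fun t _ => (hder t).differentiableAt.differentiableWithinAt)
      (fun t ht => by rw [(hder t).deriv]; exact hder_ge t (interior_subset ht))
      (a j) ⟨le_rfl, by linarith⟩ (a j + r) ⟨by linarith, le_rfl⟩ (by linarith)
    calc r / (4 * d) = 1 / (4 * d) * (a j + r - a j) := by ring
      _ ≤ _ := this
  have hlenpos : 0 < s (a j + r) - s (a j) := lt_of_lt_of_le (by positivity) hlen
  have hs1 : ∀ t, 1 ≤ 1 + s t ^ 2 ∧ 1 + s t ^ 2 ≤ 2 := fun t =>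
    ⟨by nlinarith [sq_nonneg (s t)], by linarith [halfAngleTan_sq_le_one hb t]⟩
  -- Clearing denominators costs only `2 ^ k`, because `s ^ 2 ≤ 1`.
  have hQG : ∀ u ∈ Set.Icc (s (a j)) (s (a j + r)), |Q.eval u| ≤ 2 ^ k * G := by
    intro u hu
    obtain ⟨t, ht, rfl⟩ := intermediate_value_Icc (by linarith : a j ≤ a j + r)
      hcont.continuousOn hu
    have h0 : 0 ≤ 1 + s t ^ 2 := by positivity
    rw [← hQe, abs_mul, abs_of_nonneg (pow_nonneg h0 k), mul_comm]
    exact mul_le_mul (pow_le_pow_left₀ h0 (hs1 t).2 k) (hG _ (hupd t ht))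
      (abs_nonneg _) (by positivity)
  have hxj : x j ∈ Set.Icc (a j) (a j + r) := ⟨hx.1 j, hx.2 j⟩
  have hsx : s (x j) ∈ Set.Icc (s (a j)) (s (a j + r)) := ⟨hmono hxj.1, hmono hxj.2⟩
  have hMarkov := abs_derivative_eval_le_of_abs_le hQd (sub_pos.1 hlenpos) hQG hsx
  have hfd := hasDerivAt_partialDeriv (differentiable_and_partialDeriv_mem hf).1 j x
  set D := partialDeriv j f x
  set s' := b / (√(b ^ 2 + x j ^ 2) * (b + √(b ^ 2 + x j ^ 2))) with hs'
  have hdx : HasDerivAt s s' (x j) := hder (x j)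
  -- Differentiating both sides of `hQe` at `x j` expresses `D` through the derivative of `Q` and a
  -- term controlled by `|f x|`.
  have h1 : HasDerivAt (fun t => f (Function.update x j t) * (1 + s t ^ 2) ^ k)
      (D * (1 + s (x j) ^ 2) ^ k +
        f x * (k * (1 + s (x j) ^ 2) ^ (k - 1) * (2 * s (x j) * s'))) (x j) := by
    have h := hfd.mul ((((hdx.pow 2).const_add 1)).pow k)
    refine h.congr_deriv ?_
    simp only [Pi.pow_apply, Function.update_eq_self, Nat.cast_ofNat]
    ring
  have h2 : HasDerivAt (fun t => Q.eval (s t)) (Q.derivative.eval (s (x j)) * s') (x j) :=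
    (Q.hasDerivAt (s (x j))).comp (x j) hdx
  have h3 := h1.unique (by simpa only [hQe] using! h2)
  set S := 1 + s (x j) ^ 2
  have hS := hs1 (x j)
  have hsabs : |s (x j)| ≤ 1 := (sq_le_one_iff_abs_le_one _).1 (halfAngleTan_sq_le_one hb _)
  have hs'abs : |s'| ≤ 1 := by rw [abs_of_nonneg (hder_pos _)]; exact hder_le _
  have hSk : 1 ≤ S ^ k := one_le_pow₀ hS.1
  have hfx : |f x| ≤ G := hG x hx
  have hk' : (1 : ℝ) ≤ k := by exact_mod_cast hk
  have b1 : |D| ≤ |D * S ^ k| := by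
    rw [abs_mul, abs_of_nonneg (by linarith : 0 ≤ S ^ k)]
    exact le_mul_of_one_le_right (abs_nonneg _) hSk
  have b2 : |f x * (k * S ^ (k - 1) * (2 * s (x j) * s'))| ≤ G * (k * 2 ^ k * 2) := by
    rw [abs_mul, abs_mul, abs_mul, abs_mul, abs_mul, abs_two, Nat.abs_cast,
      abs_of_nonneg (pow_nonneg (by linarith) _ : 0 ≤ S ^ (k - 1))]
    have e1 : S ^ (k - 1) ≤ 2 ^ k := (pow_le_pow_left₀ (by linarith) hS.2 _).trans
      (pow_le_pow_right₀ (by norm_num) (by omega))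
    have e2 : 2 * |s (x j)| * |s'| ≤ 2 := by nlinarith [abs_nonneg (s (x j)), abs_nonneg s']
    gcongr
  have b3 : |Q.derivative.eval (s (x j)) * s'| ≤
      4 * (2 * k : ℕ) ^ 2 / (s (a j + r) - s (a j)) * (2 ^ k * G) := by
    rw [abs_mul]
    calc _ ≤ |Q.derivative.eval (s (x j))| * 1 := by gcongr
      _ ≤ _ := by rw [mul_one]; exact hMarkov
  have b4 : 4 * ((2 * k : ℕ) : ℝ) ^ 2 / (s (a j + r) - s (a j)) * (2 ^ k * G) ≤
      64 * d * k ^ 2 * 2 ^ k / r * G := by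
    calc _ ≤ 4 * ((2 * k : ℕ) : ℝ) ^ 2 / (r / (4 * d)) * (2 ^ k * G) := by gcongr
      _ = _ := by push_cast; field_simp; ring
  have b5 : |D| ≤ 64 * d * k ^ 2 * 2 ^ k / r * G + G * (k * 2 ^ k * 2) := by
    have : D * S ^ k = Q.derivative.eval (s (x j)) * s' -
      f x * (k * S ^ (k - 1) * (2 * s (x j) * s')) := by linarith
    rw [this] at b1
    have := abs_sub (Q.derivative.eval (s (x j)) * s')
      (f x * (k * S ^ (k - 1) * (2 * s (x j) * s')))
    linarith
  refine b5.trans ?_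
  -- Polynomial factors in `k` are absorbed into exponentials: `68 * 4 * 2 = 544`, then rounded up
  -- to `1000`.
  have hk2 : (k : ℝ) ^ 2 ≤ 4 ^ k := by
    have : (k : ℝ) ≤ 2 ^ k := by exact_mod_cast (Nat.lt_two_pow_self (n := k)).le
    calc (k : ℝ) ^ 2 ≤ (2 ^ k) ^ 2 := by gcongr
      _ = 4 ^ k := by rw [← pow_mul, mul_comm, pow_mul]; norm_num
  have c1 : G * (k * 2 ^ k * 2) ≤ 4 * d * k ^ 2 * 2 ^ k / r * G := by
    rw [div_mul_eq_mul_div, le_div_iff₀ hr]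
    have : (k : ℝ) * r ≤ d * k ^ 2 * 2 := by nlinarith [mul_nonneg (by linarith : (0:ℝ) ≤ k) hr.le]
    calc G * (k * 2 ^ k * 2) * r = (2 * G * 2 ^ k) * (k * r) := by ring
      _ ≤ (2 * G * 2 ^ k) * (d * k ^ 2 * 2) := by gcongr
      _ = _ := by ring
  calc _ ≤ 64 * d * k ^ 2 * 2 ^ k / r * G + 4 * d * k ^ 2 * 2 ^ k / r * G := by linarith
    _ = (68 * d) * (k ^ 2 * 2 ^ k) / r * G := by ring
    _ ≤ (68 * d) * (4 ^ k * 2 ^ k) / r * G := by gcongr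
    _ ≤ (68 * d) ^ k * (4 ^ k * 2 ^ k) / r * G := by
        gcongr
        exact le_self_pow₀ (by linarith) (by omega)
    _ = (544 * d) ^ k / r * G := by rw [← mul_pow, ← mul_pow]; ring_nf
    _ ≤ _ := by gcongr; norm_num

end line

/-! ### Cutting a cube into boxes of equal mass -/

/-- A measure without mass on coordinate hyperplanes whose values on the boxes contained in `Q` are
comparable to their volumes. -/
structure BoxComparable {d : ℕ} (ν : Measure (Fin d → ℝ)) (Q : Set (Fin d → ℝ)) (c C : ℝ) :
    Prop where
  pos : 0 < c
  finite : ν Set.univ < ⊤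
  hyperplane : ∀ l t, ν {y | y l = t} = 0
  lower : ∀ u v, u ≤ v → Set.Icc u v ⊆ Q → c * ∏ i, (v i - u i) ≤ ν.real (Set.Icc u v)
  upper : ∀ u v, u ≤ v → Set.Icc u v ⊆ Q → ν.real (Set.Icc u v) ≤ C * ∏ i, (v i - u i)

section slicing

variable {d : ℕ} {ν : Measure (Fin d → ℝ)} {Q : Set (Fin d → ℝ)} {c C : ℝ}

theorem BoxComparable.mono (h : BoxComparable ν Q c C) {Q' : Set (Fin d → ℝ)} (hQ : Q' ⊆ Q) :
    BoxComparable ν Q' c C :=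
  ⟨h.pos, h.finite, h.hyperplane, fun u v huv hs => h.lower u v huv (hs.trans hQ),
    fun u v huv hs => h.upper u v huv (hs.trans hQ)⟩

theorem prod_update_sub_update (u v : Fin d → ℝ) (l : Fin d) (s t : ℝ) :
    ∏ i, (Function.update v l t i - Function.update u l s i) =
      (t - s) * ∏ i ∈ Finset.univ.erase l, (v i - u i) := by
  rw [← Finset.mul_prod_erase _ _ (Finset.mem_univ l)]
  simp only [Function.update_self]
  congr 1
  refine Finset.prod_congr rfl fun i hi => ?_
  rw [Function.update_of_ne (Finset.ne_of_mem_erase hi),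
    Function.update_of_ne (Finset.ne_of_mem_erase hi)]

theorem mem_Icc_update_iff {u v : Fin d → ℝ} {l : Fin d} {s t : ℝ} {y : Fin d → ℝ} :
    y ∈ Set.Icc (Function.update u l s) (Function.update v l t) ↔
      (s ≤ y l ∧ y l ≤ t) ∧ ∀ i ≠ l, u i ≤ y i ∧ y i ≤ v i := by
  simp only [Set.mem_Icc, update_le_iff, le_update_iff]
  exact ⟨fun h => ⟨⟨h.1.1, h.2.1⟩, fun i hi => ⟨h.1.2 i hi, h.2.2 i hi⟩⟩,
    fun h => ⟨⟨h.1.1, fun i hi => (h.2 i hi).1⟩, ⟨h.1.2, fun i hi => (h.2 i hi).2⟩⟩⟩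

theorem restrict_Icc_update_add (hν : BoxComparable ν Q c C) (u v : Fin d → ℝ) (l : Fin d)
    {s t w : ℝ} (hst : s ≤ t) (htw : t ≤ w) :
    ν.restrict (Set.Icc (Function.update u l s) (Function.update v l w)) =
      ν.restrict (Set.Icc (Function.update u l s) (Function.update v l t)) +
        ν.restrict (Set.Icc (Function.update u l t) (Function.update v l w)) := by
  have hunion : Set.Icc (Function.update u l s) (Function.update v l w) =
      Set.Icc (Function.update u l s) (Function.update v l t) ∪
        Set.Icc (Function.update u l t) (Function.update v l w) := by
    ext y
    simp only [Set.mem_union, mem_Icc_update_iff]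
    constructor
    · rintro ⟨⟨h1, h2⟩, h3⟩
      rcases le_total (y l) t with h | h
      · exact Or.inl ⟨⟨h1, h⟩, h3⟩
      · exact Or.inr ⟨⟨h, h2⟩, h3⟩
    · rintro (⟨⟨h1, h2⟩, h3⟩ | ⟨⟨h1, h2⟩, h3⟩)
      · exact ⟨⟨h1, h2.trans htw⟩, h3⟩
      · exact ⟨⟨hst.trans h1, h2⟩, h3⟩
  rw [hunion]
  refine Measure.restrict_union₀ ?_ measurableSet_Icc.nullMeasurableSet
  refine measure_mono_null (fun y hy => ?_) (hν.hyperplane l t)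
  exact le_antisymm (mem_Icc_update_iff.1 hy.1).1.2 (mem_Icc_update_iff.1 hy.2).1.1

/-- The mass below height `t` is Lipschitz in `t` by the upper bound, so the intermediate value
theorem yields cuts at every multiple of one `n`-th of the mass. Comparing slice and whole box with
their volumes bounds the widths. -/
theorem exists_slicing (hν : BoxComparable ν Q c C) {u v : Fin d → ℝ} (huv : ∀ i, u i < v i)
    (hQ : Set.Icc u v ⊆ Q) (l : Fin d) {n : ℕ} (hn : 0 < n) :
    ∃ s t : Fin n → ℝ,
      ν.restrict (Set.Icc u v) =
        ∑ i, ν.restrict (Set.Icc (Function.update u l (s i)) (Function.update v l (t i))) ∧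
      ∀ i, u l ≤ s i ∧ s i < t i ∧ t i ≤ v l ∧
        ν.real (Set.Icc (Function.update u l (s i)) (Function.update v l (t i))) =
          ν.real (Set.Icc u v) / n ∧
        c / C * ((v l - u l) / n) ≤ t i - s i ∧ t i - s i ≤ C / c * ((v l - u l) / n) := by
  have : IsFiniteMeasure ν := ⟨hν.finite⟩
  have hc := hν.pos
  set P := ∏ i ∈ Finset.univ.erase l, (v i - u i) with hPdef
  have hP : 0 < P := Finset.prod_pos fun i _ => sub_pos.2 (huv i)
  set B : ℝ → ℝ → Set (Fin d → ℝ) := fun s t =>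
    Set.Icc (Function.update u l s) (Function.update v l t) with hB
  have hBuv : B (u l) (v l) = Set.Icc u v := by simp [hB]
  have hBQ : ∀ s t, u l ≤ s → t ≤ v l → B s t ⊆ Q := by
    intro s t hs ht y hy
    rw [hB, mem_Icc_update_iff] at hy
    refine hQ ⟨fun i => ?_, fun i => ?_⟩ <;> rcases eq_or_ne i l with rfl | hi
    · exact hs.trans hy.1.1
    · exact (hy.2 i hi).1
    · exact hy.1.2.trans ht
    · exact (hy.2 i hi).2
  have hle : ∀ s t, s ≤ t → Function.update u l s ≤ Function.update v l t := by
    intro s t hst i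
    rcases eq_or_ne i l with rfl | hi
    · simpa using hst
    · simpa [hi] using (huv i).le
  have hlow : ∀ s t, u l ≤ s → s ≤ t → t ≤ v l → c * ((t - s) * P) ≤ ν.real (B s t) := by
    intro s t hs hst ht
    rw [hPdef, ← prod_update_sub_update]
    exact hν.lower _ _ (hle s t hst) (hBQ s t hs ht)
  have hupp : ∀ s t, u l ≤ s → s ≤ t → t ≤ v l → ν.real (B s t) ≤ C * ((t - s) * P) := by
    intro s t hs hst ht
    rw [hPdef, ← prod_update_sub_update]
    exact hν.upper _ _ (hle s t hst) (hBQ s t hs ht)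
  have hadd : ∀ s t w, s ≤ t → t ≤ w → ν.real (B s w) = ν.real (B s t) + ν.real (B t w) := by
    intro s t w hst htw
    have := congrArg (fun μ => μ.real Set.univ) (restrict_Icc_update_add hν u v l hst htw)
    rw [measureReal_add_apply] at this
    simpa [hB] using this
  set T := ν.real (Set.Icc u v) with hT
  have hlv : u l < v l := huv l
  have hTlow : c * ((v l - u l) * P) ≤ T := by
    have := hlow (u l) (v l) le_rfl hlv.le le_rfl
    rwa [hBuv] at this
  have hTupp : T ≤ C * ((v l - u l) * P) := by
    have := hupp (u l) (v l) le_rfl hlv.le le_rfl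
    rwa [hBuv] at this
  have hTpos : 0 < T := lt_of_lt_of_le
    (mul_pos hc (mul_pos (sub_pos.2 hlv) hP)) hTlow
  have hC : 0 < C := by
    by_contra hcon
    push Not at hcon
    nlinarith [mul_pos (sub_pos.2 hlv) hP]
  have hn' : (0 : ℝ) < n := by exact_mod_cast hn
  set m : ℝ → ℝ := fun t => ν.real (B (u l) t) with hm
  have hm0 : m (u l) = 0 := by
    refine le_antisymm ?_ measureReal_nonneg
    simpa using hupp (u l) (u l) le_rfl le_rfl hlv.le
  have hcont : ContinuousOn m (Set.Icc (u l) (v l)) := by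
    have : LipschitzOnWith (Real.toNNReal (C * P)) m (Set.Icc (u l) (v l)) := by
      refine LipschitzOnWith.of_le_add_mul _ fun x hx y hy => ?_
      rw [Real.coe_toNNReal _ (by positivity)]
      rcases le_total x y with h | h
      · have h1 := hadd (u l) x y hx.1 h
        have h2 : 0 ≤ C * P * dist x y := by positivity
        have h3 : 0 ≤ ν.real (B x y) := measureReal_nonneg
        simp only [hm]; linarith
      · have h1 := hadd (u l) y x hy.1 h
        have h3 := hupp y x hy.1 h hx.2
        simp only [hm]
        rw [Real.dist_eq, abs_of_nonneg (sub_nonneg.2 h)]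
        linarith
    exact this.continuousOn
  -- Indices beyond `n` get the dummy value `0`, so that the cuts form a sequence on `ℕ`.
  have hex : ∀ i : ℕ, ∃ t, i ≤ n → t ∈ Set.Icc (u l) (v l) ∧ m t = i / n * T := by
    intro i
    by_cases hi : i ≤ n
    · have hin : (i : ℝ) / n ≤ 1 := by
        rw [div_le_one hn']; exact_mod_cast hi
      have : (i : ℝ) / n * T ∈ Set.Icc (m (u l)) (m (v l)) := by
        rw [hm0, show m (v l) = T by simp only [hm]; rw [hBuv]]
        exact ⟨by positivity, by nlinarith⟩
      obtain ⟨t, ht, hmt⟩ := intermediate_value_Icc hlv.le hcont this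
      exact ⟨t, fun _ => ⟨ht, hmt⟩⟩
    · exact ⟨0, fun h => absurd h hi⟩
  choose τ hτ using hex
  have hmT : m (v l) = T := by simp only [hm]; rw [hBuv]
  have hstep : ∀ i < n, τ i ≤ τ (i + 1) ∧ ν.real (B (τ i) (τ (i + 1))) = T / n := by
    intro i hi
    obtain ⟨h1, h2⟩ := hτ i hi.le
    obtain ⟨h3, h4⟩ := hτ (i + 1) hi
    have hdiff : m (τ (i + 1)) = m (τ i) + T / n := by
      rw [h2, h4]; push_cast; ring
    have hpos : 0 < T / n := by positivity
    have hord : τ i ≤ τ (i + 1) := by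
      by_contra hcon
      push Not at hcon
      have := hadd (u l) _ _ h3.1 hcon.le
      have h5 : 0 ≤ ν.real (B (τ (i + 1)) (τ i)) := measureReal_nonneg
      simp only [hm] at hdiff
      linarith
    refine ⟨hord, ?_⟩
    have := hadd (u l) _ _ h1.1 hord
    simp only [hm] at hdiff
    linarith
  -- The chosen end cuts are forced to be the faces of the box: by the lower bound, a slab without
  -- mass has no width.
  have hτ0 : τ 0 = u l := by
    obtain ⟨h1, h2⟩ := hτ 0 (Nat.zero_le _)
    have h3 := hlow (u l) (τ 0) le_rfl h1.1 h1.2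
    have h4 : ν.real (B (u l) (τ 0)) = 0 := by simpa [hm] using h2
    rw [h4] at h3
    refine le_antisymm ?_ h1.1
    by_contra hcon
    push Not at hcon
    have := mul_pos hc (mul_pos (sub_pos.2 hcon) hP)
    linarith
  have hτn : τ n = v l := by
    obtain ⟨h1, h2⟩ := hτ n le_rfl
    have h3 := hlow (τ n) (v l) h1.1 h1.2 le_rfl
    have h4 := hadd (u l) (τ n) (v l) h1.1 h1.2
    have h5 : m (τ n) = T := by rw [h2, div_self hn'.ne', one_mul]
    simp only [hm] at h5 hmT
    refine le_antisymm h1.2 ?_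
    by_contra hcon
    push Not at hcon
    have := mul_pos hc (mul_pos (sub_pos.2 hcon) hP)
    linarith
  have hsum : ∀ i ≤ n, u l ≤ τ i ∧ ν.restrict (B (u l) (τ i)) =
      ∑ j ∈ Finset.range i, ν.restrict (B (τ j) (τ (j + 1))) := by
    intro i
    induction i with
    | zero =>
      intro _
      refine ⟨hτ0.ge, ?_⟩
      rw [Finset.range_zero, Finset.sum_empty, Measure.restrict_eq_zero]
      refine measure_mono_null (fun y hy => ?_) (hν.hyperplane l (u l))
      have := (mem_Icc_update_iff.1 hy).1
      rw [hτ0] at this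
      exact le_antisymm this.2 this.1
    | succ i ih =>
      intro hi
      obtain ⟨h1, h2⟩ := ih (by omega)
      obtain ⟨h3, -⟩ := hstep i (by omega)
      refine ⟨h1.trans h3, ?_⟩
      rw [Finset.sum_range_succ, ← h2]
      exact restrict_Icc_update_add hν u v l h1 h3
  refine ⟨fun i => τ i, fun i => τ (i + 1), ?_, fun i => ?_⟩
  · have := (hsum n le_rfl).2
    rw [hτn, hBuv] at this
    rw [this, Finset.sum_range]
  · obtain ⟨h1, -⟩ := hτ i i.2.le
    obtain ⟨h3, -⟩ := hτ (i + 1) i.2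
    obtain ⟨h5, h6⟩ := hstep i i.2
    have h7 := hlow _ _ h1.1 h5 h3.2
    have h8 := hupp _ _ h1.1 h5 h3.2
    rw [h6] at h7 h8
    have e1 : c / C * ((v l - u l) / n) ≤ τ (i + 1) - τ i := by
      rw [div_mul_div_comm, div_le_iff₀ (by positivity)]
      rw [div_le_iff₀ hn'] at h8
      have : c * (v l - u l) * P ≤ (τ (i + 1) - τ i) * (C * n) * P := by linarith
      exact le_of_mul_le_mul_right this hP
    have e2 : τ (i + 1) - τ i ≤ C / c * ((v l - u l) / n) := by
      rw [div_mul_div_comm, le_div_iff₀ (by positivity)]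
      rw [le_div_iff₀ hn'] at h7
      have : (τ (i + 1) - τ i) * (c * n) * P ≤ C * (v l - u l) * P := by linarith
      exact le_of_mul_le_mul_right this hP
    refine ⟨h1.1, ?_, h3.2, h6, e1, e2⟩
    have : 0 < c / C * ((v l - u l) / n) := by
      have := sub_pos.2 hlv
      positivity
    linarith

/-- A cube splits into `n ^ d` boxes of equal mass with sides comparable to `r / n`. -/
theorem exists_equal_mass_boxes {a : Fin d → ℝ} {r : ℝ}
    (hν : BoxComparable ν (Set.Icc a fun i => a i + r) c C) (hr : 0 < r) {n : ℕ} (hn : 0 < n) :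
    ∃ U V : Fin (n ^ d) → Fin d → ℝ,
      ν.restrict (Set.Icc a fun i => a i + r) = ∑ i, ν.restrict (Set.Icc (U i) (V i)) ∧
      ∀ i, Set.Icc (U i) (V i) ⊆ (Set.Icc a fun i => a i + r) ∧
        ν.real (Set.Icc (U i) (V i)) = ν.real (Set.Icc a fun i => a i + r) / (n ^ d : ℕ) ∧
        ∀ l, U i l < V i l ∧ c / C * (r / n) ≤ V i l - U i l ∧
          V i l - U i l ≤ C / c * (r / n) := by
  set Q := Set.Icc a fun i => a i + r with hQ
  -- Slice one direction at a time; `S` is the set of directions already cut. Sides outside `S` keep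
  -- their full length `r`, so the ratio `C / c` does not accumulate.
  suffices h : ∀ S : Finset (Fin d), ∃ (ι : Type) (_ : Fintype ι) (U V : ι → Fin d → ℝ),
      Fintype.card ι = n ^ S.card ∧
      ν.restrict Q = ∑ i, ν.restrict (Set.Icc (U i) (V i)) ∧
      ∀ i, Set.Icc (U i) (V i) ⊆ Q ∧
        ν.real (Set.Icc (U i) (V i)) = ν.real Q / (n ^ S.card : ℕ) ∧
        (∀ l, U i l < V i l) ∧
        (∀ l ∈ S, c / C * (r / n) ≤ V i l - U i l ∧ V i l - U i l ≤ C / c * (r / n)) ∧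
        ∀ l ∉ S, U i l = a l ∧ V i l = a l + r by
    obtain ⟨ι, _, U, V, hcard, hsum, hprop⟩ := h Finset.univ
    rw [Finset.card_univ, Fintype.card_fin] at hcard
    have e : Fin (n ^ d) ≃ ι := (Fintype.equivFinOfCardEq hcard).symm
    refine ⟨U ∘ e, V ∘ e, ?_, fun i => ?_⟩
    · rw [hsum]
      exact (e.sum_comp fun i => ν.restrict (Set.Icc (U i) (V i))).symm
    · obtain ⟨h1, h2, h3, h4, -⟩ := hprop (e i)
      rw [Finset.card_univ, Fintype.card_fin] at h2
      exact ⟨h1, h2, fun l => ⟨h3 l, h4 l (Finset.mem_univ l)⟩⟩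
  intro S
  induction S using Finset.induction_on with
  | empty =>
    exact ⟨Unit, inferInstance, fun _ => a, fun _ i => a i + r, by simp, by simp [hQ], fun _ =>
      ⟨subset_rfl, by simp [hQ], fun l => by linarith, by simp, fun l _ => ⟨rfl, rfl⟩⟩⟩
  | insert l S hl ih =>
    obtain ⟨ι, _, U, V, hcard, hsum, hprop⟩ := ih
    choose h1 h2 h3 h4 h5 using hprop
    choose s t hst hst' using fun i => exists_slicing hν (h3 i) (h1 i) l hn
    refine ⟨ι × Fin n, inferInstance, fun p => Function.update (U p.1) l (s p.1 p.2),
      fun p => Function.update (V p.1) l (t p.1 p.2), ?_, ?_, ?_⟩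
    · rw [Fintype.card_prod, hcard, Fintype.card_fin, Finset.card_insert_of_notMem hl, pow_succ]
    · rw [hsum, Fintype.sum_prod_type]
      exact Finset.sum_congr rfl fun i _ => hst i
    · rintro ⟨i, j⟩
      obtain ⟨k1, k2, k3, k4, k5, k6⟩ := hst' i j
      refine ⟨?_, ?_, ?_, ?_, ?_⟩
      · refine subset_trans (fun y hy => ?_) (h1 i)
        rw [mem_Icc_update_iff] at hy
        refine ⟨fun q => ?_, fun q => ?_⟩ <;> rcases eq_or_ne q l with rfl | hq
        · exact k1.trans hy.1.1
        · exact (hy.2 q hq).1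
        · exact hy.1.2.trans k3
        · exact (hy.2 q hq).2
      · simp only
        rw [k4, h2, Finset.card_insert_of_notMem hl, pow_succ, Nat.cast_mul, div_div]
      · intro q
        rcases eq_or_ne q l with rfl | hq
        · simpa using k2
        · simpa [hq] using h3 i q
      · intro q hq
        rcases eq_or_ne q l with rfl | hql
        · obtain ⟨e1, e2⟩ := h5 i q hl
          rw [e1, e2, add_sub_cancel_left] at k5 k6
          simpa only [Function.update_self] using And.intro k5 k6
        · simpa [hql] using h4 i q (Finset.mem_of_mem_insert_of_ne hq hql)
      · intro q hq
        rw [Finset.mem_insert, not_or] at hq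
        simpa [hq.1] using h5 i q hq.2

end slicing

/-! ### Exact quadrature by least squares -/

section variational

variable {d : ℕ}

theorem fderiv_apply_eq_sum (f : (Fin d → ℝ) → ℝ) (x v : Fin d → ℝ) :
    fderiv ℝ f x v = ∑ i, partialDeriv i f x * v i := by
  conv_lhs => rw [pi_eq_sum_univ' v]
  rw [map_sum]
  refine Finset.sum_congr rfl fun i _ => ?_
  rw [map_smul, smul_eq_mul, mul_comm, partialDeriv]

theorem abs_sub_le_of_abs_partialDeriv_le {f : (Fin d → ℝ) → ℝ} (hf : Differentiable ℝ f)
    {S : Set (Fin d → ℝ)} (hS : Convex ℝ S) {M : ℝ} (hM : 0 ≤ M)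
    (hfM : ∀ i, ∀ y ∈ S, |partialDeriv i f y| ≤ M) {x y : Fin d → ℝ} (hx : x ∈ S) (hy : y ∈ S) :
    |f y - f x| ≤ d * M * ‖y - x‖ := by
  refine hS.norm_image_sub_le_of_norm_fderiv_le (fun z _ => hf z) (fun z hz => ?_) hx hy
  refine ContinuousLinearMap.opNorm_le_bound _ (by positivity) fun v => ?_
  rw [fderiv_apply_eq_sum]
  refine (Finset.abs_sum_le_sum_abs _ _).trans ?_
  calc ∑ i, |partialDeriv i f z * v i| ≤ ∑ _i : Fin d, M * ‖v‖ := by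
        refine Finset.sum_le_sum fun i _ => ?_
        rw [abs_mul]
        exact mul_le_mul (hfM i z hz) (norm_le_pi_norm v i) (abs_nonneg _) hM
    _ = d * M * ‖v‖ := by simp [mul_assoc]

/-- Apply the first order bound to `f` minus its differential at `x`, on the part of `S` in the ball
of radius `‖y - x‖`: there the gradient of the difference is itself of size `d * M * ‖y - x‖`. -/
theorem abs_sub_sub_fderiv_le {f : (Fin d → ℝ) → ℝ} (hf : Differentiable ℝ f)
    (hf' : ∀ i, Differentiable ℝ (partialDeriv i f))
    {S : Set (Fin d → ℝ)} (hS : Convex ℝ S) {M : ℝ} (hM : 0 ≤ M)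
    (hfM : ∀ i j, ∀ y ∈ S, |partialDeriv i (partialDeriv j f) y| ≤ M)
    {x y : Fin d → ℝ} (hx : x ∈ S) (hy : y ∈ S) :
    |f y - f x - fderiv ℝ f x (y - x)| ≤ d ^ 2 * M * ‖y - x‖ ^ 2 := by
  have hg : Differentiable ℝ (f - ⇑(fderiv ℝ f x)) := hf.sub (fderiv ℝ f x).differentiable
  have hpd : ∀ i z, partialDeriv i (f - ⇑(fderiv ℝ f x)) z =
      partialDeriv i f z - partialDeriv i f x := by
    intro i z
    rw [partialDeriv, fderiv_sub (hf z) (fderiv ℝ f x).differentiableAt]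
    simp [partialDeriv]
  have h := abs_sub_le_of_abs_partialDeriv_le hg (hS.inter (convex_closedBall x ‖y - x‖))
    (M := d * M * ‖y - x‖) (by positivity) (fun i z hz => ?_)
    (x := x) (y := y) ⟨hx, by simp⟩ ⟨hy, by simp [dist_eq_norm]⟩
  · have e : (f - ⇑(fderiv ℝ f x)) y - (f - ⇑(fderiv ℝ f x)) x =
        f y - f x - fderiv ℝ f x (y - x) := by
      simp only [Pi.sub_apply, map_sub]; ring
    rw [e] at h
    calc _ ≤ _ := h
      _ = _ := by ring
  · rw [hpd]
    refine (abs_sub_le_of_abs_partialDeriv_le (hf' i) hS hM (fun j w hw => hfM j i w hw)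
      hx hz.1).trans ?_
    have : ‖z - x‖ ≤ ‖y - x‖ := by simpa [dist_eq_norm] using hz.2
    gcongr

variable {ν : Measure (Fin d → ℝ)} {Q : Set (Fin d → ℝ)} {c C : ℝ}

theorem BoxComparable.integrableOn (hν : BoxComparable ν Q c C) {f : (Fin d → ℝ) → ℝ}
    (hf : Continuous f) (u v : Fin d → ℝ) : IntegrableOn f (Set.Icc u v) ν := by
  have : IsFiniteMeasure ν := ⟨hν.finite⟩
  exact hf.continuousOn.integrableOn_compact isCompact_Icc

/-- A linear functional that is nonnegative on a box and vanishes at one of its points has a large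
mean. -/
theorem le_setIntegral_of_nonneg_on_box (hν : BoxComparable ν Q c C) (hC : 0 < C)
    {u v x : Fin d → ℝ} (huv : ∀ i, u i < v i) (hQ : Set.Icc u v ⊆ Q)
    (φ : (Fin d → ℝ) →L[ℝ] ℝ)
    (hφ : ∀ y ∈ Set.Icc u v, 0 ≤ φ (y - x)) (j : Fin d) :
    |φ (Pi.single j 1)| * ((v j - u j) / 2) * (c / (2 * C) * ν.real (Set.Icc u v)) ≤
      ∫ y in Set.Icc u v, φ (y - x) ∂ν := by
  have : IsFiniteMeasure ν := ⟨hν.finite⟩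
  have hc := hν.pos
  have hvu : 0 < v j - u j := sub_pos.2 (huv j)
  set mid := (u j + v j) / 2 with hmid
  -- `e` is the end of the `j`-th side towards which `φ` decreases, and `[s, t]` the half of the
  -- side away from `e`. Moving a point of the half box `H` to coordinate `e` keeps `φ` nonnegative,
  -- so on `H` it is at least its growth over half a side.
  obtain ⟨s, t, e, hs, hst, ht, hlen, he, hg⟩ : ∃ s t e : ℝ, u j ≤ s ∧ s ≤ t ∧ t ≤ v j ∧
      t - s = (v j - u j) / 2 ∧ e ∈ Set.Icc (u j) (v j) ∧ ∀ b ∈ Set.Icc s t,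
        |φ (Pi.single j 1)| * ((v j - u j) / 2) ≤ φ (Pi.single j 1) * (b - e) := by
    rcases le_total 0 (φ (Pi.single j 1)) with h | h
    · refine ⟨mid, v j, u j, by linarith, by linarith, le_rfl, by rw [hmid]; ring,
        ⟨le_rfl, by linarith⟩, fun b hb => ?_⟩
      rw [abs_of_nonneg h]
      exact mul_le_mul_of_nonneg_left (by linarith [hb.1]) h
    · refine ⟨u j, mid, v j, le_rfl, by linarith, by linarith, by rw [hmid]; ring,
        ⟨by linarith, le_rfl⟩, fun b hb => ?_⟩
      rw [abs_of_nonpos h]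
      nlinarith [hb.2]
  set H := Set.Icc (Function.update u j s) (Function.update v j t) with hH
  have hHB : H ⊆ Set.Icc u v := by
    intro y hy
    rw [hH, mem_Icc_update_iff] at hy
    refine ⟨fun i => ?_, fun i => ?_⟩ <;> rcases eq_or_ne i j with rfl | hi
    · exact hs.trans hy.1.1
    · exact (hy.2 i hi).1
    · exact hy.1.2.trans ht
    · exact (hy.2 i hi).2
  have hHlow : ∀ y ∈ H, |φ (Pi.single j 1)| * ((v j - u j) / 2) ≤ φ (y - x) := by
    intro y hy
    have hyB := hHB hy
    rw [hH, mem_Icc_update_iff] at hy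
    refine (hg (y j) hy.1).trans ?_
    have h1 : Function.update y j e ∈ Set.Icc u v := by
      refine ⟨fun i => ?_, fun i => ?_⟩ <;> rcases eq_or_ne i j with rfl | hi
      · simpa using he.1
      · simpa [hi] using hyB.1 i
      · simpa using he.2
      · simpa [hi] using hyB.2 i
    have h2 : y - x = (Function.update y j e - x) + (y j - e) • Pi.single j (1 : ℝ) := by
      funext i
      rcases eq_or_ne i j with rfl | hi
      · simp
      · simp [hi]
    rw [h2, map_add, map_smul, smul_eq_mul, mul_comm (y j - e)]
    linarith [hφ _ h1]
  -- Half the volume carries at least the fraction `c / (2 * C)` of the mass.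
  have hνH : c / (2 * C) * ν.real (Set.Icc u v) ≤ ν.real H := by
    have hle : Function.update u j s ≤ Function.update v j t := by
      intro i
      rcases eq_or_ne i j with rfl | hi
      · simpa using hst
      · simpa [hi] using (huv i).le
    have h1 := hν.lower _ _ hle (hHB.trans hQ)
    rw [prod_update_sub_update, hlen] at h1
    have h2 := hν.upper u v (fun i => (huv i).le) hQ
    rw [← Finset.mul_prod_erase _ _ (Finset.mem_univ j)] at h2
    calc c / (2 * C) * ν.real (Set.Icc u v) ≤ c / (2 * C) *
          (C * ((v j - u j) * ∏ i ∈ Finset.univ.erase j, (v i - u i))) := by gcongr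
      _ = _ := by field_simp
      _ ≤ _ := h1
  have hint : IntegrableOn (fun y => φ (y - x)) (Set.Icc u v) ν :=
    hν.integrableOn (φ.continuous.comp (continuous_id.sub continuous_const)) u v
  calc _ ≤ |φ (Pi.single j 1)| * ((v j - u j) / 2) * ν.real H := by gcongr
    _ ≤ ∫ y in H, φ (y - x) ∂ν := by
        refine setIntegral_ge_of_const_le_real measurableSet_Icc (measure_ne_top _ _) hHlow ?_
        exact hint.mono_set hHB
    _ ≤ _ := by
        refine setIntegral_mono_set hint ?_ hHB.eventuallyLE
        exact (ae_restrict_mem measurableSet_Icc).mono fun y hy => hφ y hy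

/-- First order optimality of a choice of points in boxes that minimises the squared distance of
finitely many averages from prescribed values. -/
theorem exists_critical_points {N : ℕ} (hN : 0 < N) (U V : Fin N → Fin d → ℝ)
    (hUV : ∀ i, U i ≤ V i) (T : Finset ((Fin d → ℝ) → ℝ)) (hT : ∀ f ∈ T, Differentiable ℝ f)
    (m : ((Fin d → ℝ) → ℝ) → ℝ) :
    ∃ (x : Fin N → Fin d → ℝ) (e : ((Fin d → ℝ) → ℝ) → ℝ),
      (∀ i, x i ∈ Set.Icc (U i) (V i)) ∧ (∀ f, e f = (∑ i, f (x i)) / N - m f) ∧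
      ∀ i, ∀ y ∈ Set.Icc (U i) (V i), 0 ≤ fderiv ℝ (∑ f ∈ T, e f • f) (x i) (y - x i) := by
  have hN' : (0 : ℝ) < N := by exact_mod_cast hN
  set F : (Fin N → Fin d → ℝ) → ℝ := fun x => ∑ f ∈ T, ((∑ i, f (x i)) / N - m f) ^ 2 with hF
  have hFc : Continuous F := by
    refine continuous_finsetSum _ fun f hf => ?_
    refine Continuous.pow (Continuous.sub (Continuous.div_const ?_ _) continuous_const) 2
    exact continuous_finsetSum _ fun i _ => (hT f hf).continuous.comp (continuous_apply i)
  obtain ⟨x, hx, hmin⟩ :=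
    (isCompact_univ_pi fun i => isCompact_Icc (a := U i) (b := V i)).exists_isMinOn
    ⟨U, fun i _ => ⟨le_rfl, hUV i⟩⟩ hFc.continuousOn
  refine ⟨x, fun f => (∑ i, f (x i)) / N - m f, fun i => hx i trivial, fun f => rfl, ?_⟩
  intro i y hy
  set e : ((Fin d → ℝ) → ℝ) → ℝ := fun f => (∑ i, f (x i)) / N - m f with he
  have hsumupd : ∀ f : (Fin d → ℝ) → ℝ, ∀ z, (∑ q, f (Function.update x i z q)) / N - m f =
      e f + (f z - f (x i)) / N := by
    intro f z
    rw [he]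
    simp only
    rw [← Finset.add_sum_erase _ _ (Finset.mem_univ i),
      ← Finset.add_sum_erase Finset.univ (fun q => f (x q)) (Finset.mem_univ i)]
    have : ∑ q ∈ Finset.univ.erase i, f (Function.update x i z q) =
        ∑ q ∈ Finset.univ.erase i, f (x q) := Finset.sum_congr rfl fun q hq => by
      rw [Function.update_of_ne (Finset.ne_of_mem_erase hq)]
    rw [this, Function.update_self]
    ring
  have hmin' : IsMinOn (fun z => F (Function.update x i z)) (Set.Icc (U i) (V i)) (x i) := by
    intro z hz
    simp only [Set.mem_ofPred_eq, Function.update_eq_self]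
    refine hmin fun q _ => ?_
    rcases eq_or_ne q i with rfl | hq
    · simpa using hz
    · simpa [hq] using hx q trivial
  have hpd : Differentiable ℝ (∑ f ∈ T, e f • f) :=
    Differentiable.sum fun f hf => (hT f hf).const_smul _
  -- When only node `i` moves, each average changes at rate `1 / N`, so the gradient of the sum of
  -- squares is that of the error-weighted combination, times `2 / N`.
  have hder : HasFDerivAt (fun z => F (Function.update x i z))
      ((2 / N : ℝ) • fderiv ℝ (∑ f ∈ T, e f • f) (x i)) (x i) := by
    have h1 : HasFDerivAt (fun z => ∑ f ∈ T, (e f + (f z - f (x i)) / N) ^ 2)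
        (∑ f ∈ T, (2 / N * e f) • fderiv ℝ f (x i)) (x i) := by
      refine HasFDerivAt.fun_sum fun f hf => ?_
      have h2 := ((((hT f hf) (x i)).hasFDerivAt.sub_const (f (x i))).mul_const (N : ℝ)⁻¹).const_add
        (e f)
      have h3 := h2.pow 2
      simp only [← div_eq_mul_inv] at h3
      refine h3.congr_fderiv ?_
      ext w
      simp
      ring
    simp only [hF, hsumupd]
    refine h1.congr_fderiv ?_
    have h4 : fderiv ℝ (∑ f ∈ T, e f • f) (x i) = ∑ f ∈ T, e f • fderiv ℝ f (x i) := by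
      rw [fderiv_sum fun f hf => ((hT f hf).const_smul _) (x i)]
      exact Finset.sum_congr rfl fun f hf => fderiv_const_smul ((hT f hf) (x i)) _
    rw [h4, Finset.smul_sum]
    exact Finset.sum_congr rfl fun f _ => by rw [smul_smul]
  have hcone : y - x i ∈ posTangentConeAt (Set.Icc (U i) (V i)) (x i) :=
    sub_mem_posTangentConeAt_of_segment_subset ((convex_Icc _ _).segment_subset (hx i trivial) hy)
  have := hmin'.localize.hasFDerivWithinAt_nonneg hder.hasFDerivWithinAt hcone
  rw [smul_apply, smul_eq_mul] at this
  exact nonneg_of_mul_nonneg_right this (by positivity)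

/-- A cube contains a box of side `η` within distance `η` of any of its points. -/
theorem exists_box_near {a x : Fin d → ℝ} {r η : ℝ} (hη : 0 ≤ η) (hηr : η ≤ r)
    (hx : x ∈ Set.Icc a fun i => a i + r) :
    ∃ w : Fin d → ℝ, (Set.Icc w fun i => w i + η) ⊆ (Set.Icc a fun i => a i + r) ∧
      ∀ y ∈ Set.Icc w fun i => w i + η, ‖y - x‖ ≤ η := by
  refine ⟨fun i => max (a i) (x i - η), fun y hy => ⟨fun i => ?_, fun i => ?_⟩, fun y hy => ?_⟩
  · exact (le_max_left _ _).trans (hy.1 i)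
  · refine (hy.2 i).trans ?_
    have := hx.2 i
    simp only at this ⊢
    rcases max_choice (a i) (x i - η) with h | h <;> rw [h] <;> linarith
  · refine (pi_norm_le_iff_of_nonneg hη).2 fun i => ?_
    have h1 := hy.1 i
    have h2 := hy.2 i
    have h3 := hx.1 i
    simp only at h1 h2
    rw [Pi.sub_apply, Real.norm_eq_abs, abs_le]
    refine ⟨by linarith [le_max_right (a i) (x i - η)], ?_⟩
    rcases max_choice (a i) (x i - η) with h | h <;> rw [h] at h2 <;> linarith

/-- The least squares argument. The sum of squared errors is the quadrature error of the single
function `p`. First order optimality bounds it above by remainders minus a gain proportional to the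
mean of one partial derivative in absolute value. Taking the partial derivative with the largest
maximum, `hMarkov` controls all second derivatives by that maximum, and also keeps this derivative
large on a small cube, so the gain wins. -/
theorem exists_equal_weight_quadrature (hd : 0 < d) {a : Fin d → ℝ} {r A : ℝ} (hr : 0 < r)
    (hν : BoxComparable ν (Set.Icc a fun i => a i + r) c C) (W : Submodule ℝ ((Fin d → ℝ) → ℝ))
    (hW : W.FG) (hdiff : ∀ p ∈ W, Differentiable ℝ p)
    (hdiff' : ∀ p ∈ W, ∀ j, Differentiable ℝ (partialDeriv j p)) (hA : 1 ≤ A)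
    (hMarkov : ∀ p ∈ W, ∀ j G, (∀ y ∈ Set.Icc a fun i => a i + r, |partialDeriv j p y| ≤ G) →
      ∀ i, ∀ y ∈ Set.Icc a fun i => a i + r, |partialDeriv i (partialDeriv j p) y| ≤ A / r * G)
    {n : ℕ} (hn : 16 * (C / c) ^ 5 * d ^ 2 * A * (2 * d * A) ^ d ≤ n) :
    ∃ z : Fin (n ^ d) → Fin d → ℝ, (∀ i, z i ∈ Set.Icc a fun i => a i + r) ∧
      ∀ p ∈ W, (∑ i, p (z i)) / (n ^ d : ℕ) =
        (∫ y in Set.Icc a fun i => a i + r, p y ∂ν) /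
          ν.real (Set.Icc a fun i => a i + r) := by
  have hfin : IsFiniteMeasure ν := ⟨hν.finite⟩
  set Q := Set.Icc a fun i => a i + r with hQdef
  have hc := hν.pos
  have hd1 : (1 : ℝ) ≤ d := by exact_mod_cast hd
  have hle : a ≤ fun i => a i + r := fun i => by simp only; linarith
  have hQlow : c * r ^ d ≤ ν.real Q := by simpa using hν.lower a _ hle subset_rfl
  have hQupp : ν.real Q ≤ C * r ^ d := by simpa using hν.upper a _ hle subset_rfl
  have hrd : 0 < r ^ d := pow_pos hr d
  have hcC : c ≤ C := le_of_mul_le_mul_right (hQlow.trans hQupp) hrd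
  have hC : 0 < C := hc.trans_le hcC
  have hw : 0 < ν.real Q := lt_of_lt_of_le (mul_pos hc hrd) hQlow
  set κ := C / c with hκdef
  have hκ : 1 ≤ κ := (one_le_div hc).2 hcC
  have hn0 : (0 : ℝ) < n := lt_of_lt_of_le (by positivity) hn
  have hn0' : 0 < n := by exact_mod_cast hn0
  have hboxes := exists_equal_mass_boxes hν hr hn0'
  obtain ⟨N, hN⟩ : ∃ N, N = n ^ d := ⟨_, rfl⟩
  rw [← hN, ← hQdef] at hboxes
  rw [← hN]
  obtain ⟨U, V, hsum, hbox⟩ := hboxes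
  have hNpos : 0 < N := hN ▸ pow_pos hn0' d
  have hNpos' : (0 : ℝ) < (N : ℝ) := by exact_mod_cast hNpos
  obtain ⟨T, hT⟩ := hW
  have hTW : ∀ f ∈ T, f ∈ W := fun f hf => hT ▸ Submodule.subset_span hf
  obtain ⟨x, e, hxB, he, hcrit⟩ := exists_critical_points hNpos U V
    (fun i l => ((hbox i).2.2 l).1.le) T (fun f hf => hdiff f (hTW f hf))
    (fun f => (∫ y in Q, f y ∂ν) / ν.real Q)
  have hxQ : ∀ i, x i ∈ Q := fun i => (hbox i).1 (hxB i)
  have hintegral : ∀ f : (Fin d → ℝ) → ℝ, Continuous f →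
      ∫ y in Q, f y ∂ν = ∑ i, ∫ y in Set.Icc (U i) (V i), f y ∂ν := by
    intro f hf
    rw [hsum]
    exact integral_finsetSum_measure fun i _ => hν.integrableOn hf _ _
  set p := ∑ f ∈ T, e f • f with hp
  have hpW : p ∈ W := Submodule.sum_mem _ fun f hf => Submodule.smul_mem _ _ (hTW f hf)
  have hpd := hdiff p hpW
  have hpd' := hdiff' p hpW
  -- the largest partial derivative
  have hQne : Q.Nonempty := ⟨a, le_rfl, hle⟩
  have hmax : ∀ j, ∃ y ∈ Q, ∀ z ∈ Q, |partialDeriv j p z| ≤ |partialDeriv j p y| := fun j =>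
    isCompact_Icc.exists_isMaxOn hQne (hpd' j).continuous.abs.continuousOn
  choose ym hymQ hym using hmax
  have : Nonempty (Fin d) := ⟨⟨0, hd⟩⟩
  obtain ⟨j, hj⟩ := Finite.exists_max fun j => |partialDeriv j p (ym j)|
  set G := |partialDeriv j p (ym j)| with hG
  have hG0 : 0 ≤ G := abs_nonneg _
  have hgrad : ∀ i, ∀ y ∈ Q, |partialDeriv i p y| ≤ G := fun i y hy => (hym i y hy).trans (hj i)
  have hhess : ∀ i i', ∀ y ∈ Q, |partialDeriv i (partialDeriv i' p) y| ≤ A / r * G :=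
    fun i i' => hMarkov p hpW i' G (hgrad i') i
  have hM0 : 0 ≤ A / r * G := by positivity
  set g := partialDeriv j p with hg
  have hgc : Continuous fun y => |g y| := (hpd' j).continuous.abs
  have hglip : ∀ y ∈ Q, ∀ z ∈ Q, |g z - g y| ≤ d * (A / r * G) * ‖z - y‖ := fun y hy z hz =>
    abs_sub_le_of_abs_partialDeriv_le (hpd' j) (convex_Icc _ _) hM0 (fun i w hw => hhess i j w hw)
      hy hz
  set w := ν.real Q with hwdef
  -- the mean of `|g|` is large
  have hgmean : G / (2 * κ * (2 * d * A) ^ d) * w ≤ ∫ y in Q, |g y| ∂ν := by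
    -- At this scale the Lipschitz bound allows `g` to lose at most half of its maximum `G`.
    set η := r / (2 * d * A) with hη
    have hdA : 1 ≤ 2 * d * A := by nlinarith
    have hη0 : 0 < η := by positivity
    have hηr : η ≤ r := div_le_self hr.le hdA
    obtain ⟨b, hbQ, hbx⟩ := exists_box_near hη0.le hηr (hymQ j)
    have h1 : c * η ^ d ≤ ν.real (Set.Icc b fun i => b i + η) := by
      simpa using hν.lower b (fun i => b i + η) (fun i => by simp only; linarith) hbQ
    have h2 : ∀ y ∈ Set.Icc b fun i => b i + η, G / 2 ≤ |g y| := by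
      intro y hy
      have h3 := hglip (ym j) (hymQ j) y (hbQ hy)
      have h4 : d * (A / r * G) * ‖y - ym j‖ ≤ d * (A / r * G) * η := by
        gcongr; exact hbx y hy
      have h5 : d * (A / r * G) * η = G / 2 := by rw [hη]; field_simp
      have h6 := abs_sub_abs_le_abs_sub (g (ym j)) (g y)
      rw [abs_sub_comm] at h6
      linarith
    calc G / (2 * κ * (2 * d * A) ^ d) * w ≤ G / (2 * κ * (2 * d * A) ^ d) * (C * r ^ d) := by
          gcongr
      _ = G / 2 * (c * η ^ d) := by rw [hη, hκdef, div_pow]; field_simp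
      _ ≤ G / 2 * ν.real (Set.Icc b fun i => b i + η) := by gcongr
      _ ≤ ∫ y in Set.Icc b fun i => b i + η, |g y| ∂ν :=
          setIntegral_ge_of_const_le_real measurableSet_Icc (measure_ne_top _ _) h2
            (hν.integrableOn hgc _ _)
      _ ≤ _ := setIntegral_mono_set (hν.integrableOn hgc _ _)
          (Filter.Eventually.of_forall fun y => abs_nonneg _) hbQ.eventuallyLE
  -- the contribution of one box
  set h := κ * (r / n) with hh
  have hh0 : 0 < h := by positivity
  have hdist : ∀ i, ∀ y ∈ Set.Icc (U i) (V i), ‖y - x i‖ ≤ h := by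
    intro i y hy
    refine (pi_norm_le_iff_of_nonneg hh0.le).2 fun l => ?_
    obtain ⟨-, -, hl⟩ := (hbox i).2.2 l
    rw [Pi.sub_apply, Real.norm_eq_abs, abs_le]
    constructor <;> linarith [hy.1 l, hy.2 l, (hxB i).1 l, (hxB i).2 l]
  -- The factor is half the least side `r / (κ * n)` times the mass fraction `1 / (2 * κ)` of a half
  -- box. The first subtraction pays for replacing `|g (x i)|` by the box average of `|g|`, the
  -- second is the Taylor remainder.
  have hone : ∀ i, r / (4 * κ ^ 2 * n) *
        ((∫ y in Set.Icc (U i) (V i), |g y| ∂ν) - d * (A / r * G) * h * (w / N)) -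
        d ^ 2 * (A / r * G) * h ^ 2 * (w / N) ≤
      (∫ y in Set.Icc (U i) (V i), p y ∂ν) - w / N * p (x i) := by
    intro i
    obtain ⟨hBQ, hmass, hsides⟩ := hbox i
    have hlin := le_setIntegral_of_nonneg_on_box hν hC (fun l => (hsides l).1) hBQ
      (fderiv ℝ p (x i)) (hcrit i) j
    rw [hmass] at hlin
    have hpt : ∀ y ∈ Set.Icc (U i) (V i), fderiv ℝ p (x i) (y - x i) - d ^ 2 * (A / r * G) * h ^ 2 ≤
        p y - p (x i) := by
      intro y hy
      have h1 := (abs_le.1 (abs_sub_sub_fderiv_le hpd hpd' (convex_Icc _ _) hM0 hhess (hxQ i)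
        (hBQ hy))).1
      have h2 : d ^ 2 * (A / r * G) * ‖y - x i‖ ^ 2 ≤ d ^ 2 * (A / r * G) * h ^ 2 := by
        gcongr; exact hdist i y hy
      linarith
    have hi1 : IntegrableOn (fun y => fderiv ℝ p (x i) (y - x i)) (Set.Icc (U i) (V i)) ν :=
      hν.integrableOn ((fderiv ℝ p (x i)).continuous.comp (continuous_id.sub continuous_const)) _ _
    have hi2 : IntegrableOn p (Set.Icc (U i) (V i)) ν := hν.integrableOn hpd.continuous _ _
    have hic : ∀ b : ℝ, IntegrableOn (fun _ => b) (Set.Icc (U i) (V i)) ν := fun b =>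
      hν.integrableOn continuous_const _ _
    have h3 := setIntegral_mono_on (hi1.sub (hic (d ^ 2 * (A / r * G) * h ^ 2)))
      (hi2.sub (hic (p (x i)))) measurableSet_Icc hpt
    simp only [Pi.sub_apply] at h3
    rw [integral_sub hi1 (hic _), integral_sub hi2 (hic _), setIntegral_const, setIntegral_const,
      hmass, smul_eq_mul, smul_eq_mul] at h3
    have hgpt : ∀ y ∈ Set.Icc (U i) (V i), |g y| ≤ |g (x i)| + d * (A / r * G) * h := by
      intro y hy
      have h1 := hglip (x i) (hxQ i) y (hBQ hy)
      have h2 : d * (A / r * G) * ‖y - x i‖ ≤ d * (A / r * G) * h := by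
        gcongr; exact hdist i y hy
      have h4 := abs_sub_abs_le_abs_sub (g y) (g (x i))
      linarith
    have h4 := setIntegral_mono_on (hν.integrableOn hgc _ _) (hic _) measurableSet_Icc hgpt
    rw [setIntegral_const, hmass, smul_eq_mul] at h4
    have hwN : 0 ≤ w / N := by positivity
    have h5 : r / (4 * κ ^ 2 * n) * (|g (x i)| * (w / N)) ≤
        |fderiv ℝ p (x i) (Pi.single j 1)| * ((V i j - U i j) / 2) * (c / (2 * C) * (w / N)) := by
      have h6 : |fderiv ℝ p (x i) (Pi.single j 1)| = |g (x i)| := rfl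
      rw [h6]
      have h7 := (hsides j).2.1
      calc _ = |g (x i)| * (c / C * (r / n) / 2) * (c / (2 * C) * (w / N)) := by
            rw [hκdef]; field_simp; ring
        _ ≤ _ := by gcongr
    have h8 : r / (4 * κ ^ 2 * n) *
        ((∫ y in Set.Icc (U i) (V i), |g y| ∂ν) - d * (A / r * G) * h * (w / N)) ≤
        r / (4 * κ ^ 2 * n) * (|g (x i)| * (w / N)) := by
      refine mul_le_mul_of_nonneg_left ?_ (by positivity)
      linarith
    linarith
  have htotal := Finset.sum_le_sum fun i (_ : i ∈ Finset.univ) => hone i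
  rw [Finset.sum_sub_distrib, ← Finset.mul_sum, Finset.sum_sub_distrib, Finset.sum_sub_distrib,
    ← hintegral _ hgc, ← hintegral _ hpd.continuous, Finset.sum_const, Finset.sum_const,
    Finset.card_univ, Fintype.card_fin, nsmul_eq_mul, nsmul_eq_mul, ← Finset.mul_sum] at htotal
  have hkey : 0 ≤ (∫ y in Q, p y ∂ν) - w / N * ∑ i, p (x i) := by
    refine le_trans ?_ htotal
    have h1 : (N : ℝ) * (d * (A / r * G) * h * (w / N)) = d * A * κ / n * (G * w) := by
      rw [hh]; field_simp
    have h2 : (N : ℝ) * (d ^ 2 * (A / r * G) * h ^ 2 * (w / N)) =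
        r / (4 * κ ^ 2 * n) * (4 * d ^ 2 * A * κ ^ 4 / n * (G * w)) := by
      rw [hh]; field_simp
    rw [h1, h2, ← mul_sub]
    refine mul_nonneg (by positivity) ?_
    -- Both losses are at most `4 * d ^ 2 * A * κ ^ 4 / n`; against the gain `1 / (2 * κ * (2 * d *
    -- A) ^ d)` this gives exactly the threshold `hn`.
    have h3 : (d * A * κ / n + 4 * d ^ 2 * A * κ ^ 4 / n) * (G * w) ≤
        1 / (2 * κ * (2 * d * A) ^ d) * (G * w) := by
      refine mul_le_mul_of_nonneg_right ?_ (by positivity)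
      rw [← add_div, div_le_div_iff₀ hn0 (by positivity), one_mul]
      refine le_trans ?_ hn
      have h4 : d * A * κ ≤ 4 * d ^ 2 * A * κ ^ 4 := by
        have e1 : κ ≤ κ ^ 4 := le_self_pow₀ hκ (by norm_num)
        have e2 : (d : ℝ) ≤ 4 * d ^ 2 := by nlinarith
        calc d * A * κ ≤ 4 * d ^ 2 * A * κ ^ 4 := by gcongr
          _ = _ := rfl
      calc _ ≤ (4 * d ^ 2 * A * κ ^ 4 + 4 * d ^ 2 * A * κ ^ 4) * (2 * κ * (2 * d * A) ^ d) := by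
            gcongr
        _ = _ := by ring
    have h5 : G / (2 * κ * (2 * d * A) ^ d) * w = 1 / (2 * κ * (2 * d * A) ^ d) * (G * w) := by
      ring
    rw [h5] at hgmean
    linarith
  -- hence all errors vanish
  have hsq : ∑ f ∈ T, e f ^ 2 = (∑ i, p (x i)) / N - (∫ y in Q, p y ∂ν) / w := by
    have h1 : ∀ y, p y = ∑ f ∈ T, e f * f y := fun y => by simp [hp, Finset.sum_apply]
    have h2 : ∫ y in Q, p y ∂ν = ∑ f ∈ T, e f * ∫ y in Q, f y ∂ν := by
      simp only [h1]
      rw [integral_finsetSum _ fun f hf =>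
        (hν.integrableOn (hdiff f (hTW f hf)).continuous _ _).const_mul _]
      exact Finset.sum_congr rfl fun f _ => integral_const_mul _ _
    have h3 : ∑ i, p (x i) = ∑ f ∈ T, e f * ∑ i, f (x i) := by
      simp only [h1, Finset.mul_sum]
      exact Finset.sum_comm
    rw [h2, h3, Finset.sum_div, Finset.sum_div, ← Finset.sum_sub_distrib]
    refine Finset.sum_congr rfl fun f _ => ?_
    rw [mul_div_assoc, mul_div_assoc, ← mul_sub, ← he, sq]
  -- The coefficients of `p` are the errors themselves, so its quadrature error is a sum of squares,
  -- while `hkey` makes it nonpositive.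
  have hsq0 : ∑ f ∈ T, e f ^ 2 ≤ 0 := by
    rw [hsq, sub_nonpos, le_div_iff₀ hw]
    calc _ = w / N * ∑ i, p (x i) := by ring
      _ ≤ _ := by linarith
  have he0 : ∀ f ∈ T, e f = 0 := fun f hf => by
    have h1 := (Finset.sum_eq_zero_iff_of_nonneg fun f (_ : f ∈ T) => sq_nonneg (e f)).1
      (le_antisymm hsq0 (Finset.sum_nonneg fun f _ => sq_nonneg _)) f hf
    exact pow_eq_zero_iff two_ne_zero |>.1 h1
  refine ⟨x, hxQ, fun f hf => ?_⟩
  -- Exactness passes from the spanning set to `W` by linearity; continuity is carried along for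
  -- integrability.
  suffices hs : Continuous f ∧ (∑ i, f (x i)) / (N : ℝ) = (∫ y in Q, f y ∂ν) / w from hs.2
  rw [← hT] at hf
  induction hf using Submodule.span_induction with
  | mem f hf =>
    refine ⟨(hdiff f (hTW f hf)).continuous, ?_⟩
    have h1 := he f
    rw [he0 f hf] at h1
    linarith
  | zero => exact ⟨continuous_const, by simp⟩
  | add f f' _ _ hf hf' =>
    refine ⟨hf.1.add hf'.1, ?_⟩
    simp only [Pi.add_apply]
    rw [integral_add (hν.integrableOn hf.1 _ _) (hν.integrableOn hf'.1 _ _),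
      Finset.sum_add_distrib, add_div, add_div, hf.2, hf'.2]
  | smul b f _ hf =>
    refine ⟨hf.1.const_smul b, ?_⟩
    simp only [Pi.smul_apply, smul_eq_mul]
    rw [integral_const_mul, ← Finset.mul_sum, mul_div_assoc, mul_div_assoc, hf.2]

end variational

/-- The sign `1` or `-1`. -/
def boolSign (b : Bool) : ℝ := if b then 1 else -1

theorem boolSign_mul_self (b : Bool) : boolSign b * boolSign b = 1 := by
  cases b <;> simp [boolSign]

theorem abs_boolSign (b : Bool) : |boolSign b| = 1 := by
  cases b <;> simp [boolSign]

/-! ### The gnomonic charts of the sphere -/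

section chart

variable {d : ℕ}

/-- The point of the face `z l = ± 1` of the cube with the other coordinates `y`. -/
def facePoint (f : Fin (d + 1) × Bool) (y : Fin d → ℝ) : EuclideanSpace ℝ (Fin (d + 1)) :=
  WithLp.toLp 2 (Fin.insertNth (α := fun _ => ℝ) f.1 (boolSign f.2) y)

/-- The central projection of a face of the cube to the sphere. -/
def gnomonicChart (f : Fin (d + 1) × Bool) (y : Fin d → ℝ) : EuclideanSpace ℝ (Fin (d + 1)) :=
  gnomonicHeight y • facePoint f y

/-- The inverse of the central projection of a face. -/
def gnomonicInv (f : Fin (d + 1) × Bool) (z : EuclideanSpace ℝ (Fin (d + 1))) : Fin d → ℝ :=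
  fun i => z (f.1.succAbove i) / (boolSign f.2 * z f.1)

variable (f : Fin (d + 1) × Bool)

theorem facePoint_self (y : Fin d → ℝ) : facePoint f y f.1 = boolSign f.2 := by
  simp [facePoint]

theorem facePoint_succAbove (y : Fin d → ℝ) (i : Fin d) :
    facePoint f y (f.1.succAbove i) = y i := by
  simp [facePoint]

theorem gnomonicChart_self (y : Fin d → ℝ) :
    gnomonicChart f y f.1 = boolSign f.2 * gnomonicHeight y := by
  rw [gnomonicChart, PiLp.smul_apply, facePoint_self, smul_eq_mul, mul_comm]

theorem gnomonicChart_succAbove (y : Fin d → ℝ) (i : Fin d) :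
    gnomonicChart f y (f.1.succAbove i) = y i * gnomonicHeight y := by
  rw [gnomonicChart, PiLp.smul_apply, facePoint_succAbove, smul_eq_mul, mul_comm]

theorem norm_facePoint (y : Fin d → ℝ) : ‖facePoint f y‖ = √(1 + ∑ i, y i ^ 2) := by
  rw [EuclideanSpace.norm_eq, Fin.sum_univ_succAbove _ f.1, facePoint_self]
  simp only [facePoint_succAbove, Real.norm_eq_abs, abs_boolSign, sq_abs, one_pow]

theorem gnomonicHeight_eq (y : Fin d → ℝ) : gnomonicHeight y = ‖facePoint f y‖⁻¹ := by
  rw [norm_facePoint, gnomonicHeight]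

theorem one_le_norm_facePoint (y : Fin d → ℝ) : 1 ≤ ‖facePoint f y‖ := by
  have h : 0 ≤ ∑ i, y i ^ 2 := Finset.sum_nonneg fun _ _ => sq_nonneg _
  rw [norm_facePoint]
  exact Real.one_le_sqrt.2 (by linarith)

theorem norm_gnomonicChart (y : Fin d → ℝ) : ‖gnomonicChart f y‖ = 1 := by
  rw [gnomonicChart, norm_smul, Real.norm_of_nonneg (gnomonicHeight_pos y).le,
    gnomonicHeight_eq f]
  exact inv_mul_cancel₀ (by linarith [one_le_norm_facePoint f y])

theorem gnomonicInv_gnomonicChart (y : Fin d → ℝ) : gnomonicInv f (gnomonicChart f y) = y := by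
  funext i
  rw [gnomonicInv, gnomonicChart_self, gnomonicChart_succAbove, ← mul_assoc, boolSign_mul_self,
    one_mul, mul_div_cancel_right₀ _ (gnomonicHeight_pos y).ne']

theorem dist_facePoint_le (x y : Fin d → ℝ) :
    dist (facePoint f x) (facePoint f y) ≤ d * dist x y := by
  rw [EuclideanSpace.dist_eq, Fin.sum_univ_succAbove _ f.1]
  simp only [facePoint_self, facePoint_succAbove, dist_self]
  refine Real.sqrt_le_left (by positivity) |>.2 ?_
  have h : ∑ i, dist (x i) (y i) ^ 2 ≤ ∑ _i : Fin d, dist x y ^ 2 :=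
    Finset.sum_le_sum fun i _ => pow_le_pow_left₀ dist_nonneg (dist_le_pi_dist x y i) 2
  rw [Finset.sum_const, Finset.card_univ, Fintype.card_fin, nsmul_eq_mul] at h
  have hd : (d : ℝ) ≤ d ^ 2 := by exact_mod_cast Nat.le_self_pow two_ne_zero d
  calc _ ≤ (d : ℝ) * dist x y ^ 2 := by simpa using h
    _ ≤ d ^ 2 * dist x y ^ 2 := by gcongr
    _ = _ := by ring

/-- Face points have norm at least one, so normalising them at most doubles distances: one `‖u - v‖`
for the direction and one for the change of norm. -/
theorem dist_gnomonicChart_le (x y : Fin d → ℝ) :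
    dist (gnomonicChart f x) (gnomonicChart f y) ≤ 2 * d * dist x y := by
  set u := facePoint f x with hu
  set v := facePoint f y with hv
  have hu1 : 1 ≤ ‖u‖ := one_le_norm_facePoint f x
  have hv1 : 1 ≤ ‖v‖ := one_le_norm_facePoint f y
  have hu0 : 0 < ‖u‖ := by linarith
  have hv0 : 0 < ‖v‖ := by linarith
  have huv := dist_facePoint_le f x y
  rw [← hu, ← hv, dist_eq_norm] at huv
  have e : gnomonicChart f x - gnomonicChart f y =
      ‖u‖⁻¹ • (u - v) + (‖u‖⁻¹ - ‖v‖⁻¹) • v := by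
    rw [gnomonicChart, gnomonicChart, gnomonicHeight_eq f, gnomonicHeight_eq f, ← hu, ← hv,
      smul_sub, sub_smul]
    abel
  rw [dist_eq_norm, e]
  have h1 : ‖‖u‖⁻¹ • (u - v)‖ ≤ ‖u - v‖ := by
    rw [norm_smul, Real.norm_of_nonneg (by positivity)]
    exact mul_le_of_le_one_left (norm_nonneg _) (inv_le_one_of_one_le₀ hu1)
  have h2 : ‖(‖u‖⁻¹ - ‖v‖⁻¹) • v‖ ≤ ‖u - v‖ := by
    have e2 : (‖u‖⁻¹ - ‖v‖⁻¹) * ‖v‖ = ‖u‖⁻¹ * (‖v‖ - ‖u‖) := by field_simp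
    rw [norm_smul, Real.norm_eq_abs, ← abs_of_pos hv0, ← abs_mul, abs_of_pos hv0, e2, abs_mul,
      abs_of_pos (inv_pos.2 hu0)]
    calc _ ≤ 1 * |‖v‖ - ‖u‖| := by gcongr; exact inv_le_one_of_one_le₀ hu1
      _ ≤ _ := by rw [one_mul, norm_sub_rev]; exact abs_norm_sub_norm_le _ _
  calc _ ≤ _ := norm_add_le _ _
    _ ≤ d * dist x y + d * dist x y := add_le_add (h1.trans huv) (h2.trans huv)
    _ = _ := by ring

theorem continuous_gnomonicChart : Continuous (gnomonicChart f) :=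
  (LipschitzWith.of_dist_le_mul (K := ⟨2 * d, by positivity⟩)
    fun x y => dist_gnomonicChart_le f x y).continuous

theorem measurable_gnomonicInv : Measurable (gnomonicInv f) := by
  refine measurable_pi_lambda _ fun i => ?_
  have h : ∀ q, Measurable fun z : EuclideanSpace ℝ (Fin (d + 1)) => z q := fun q =>
    (EuclideanSpace.proj (𝕜 := ℝ) q).continuous.measurable
  exact (h _).div (measurable_const.mul (h _))

theorem abs_apply_le_dist (z w : EuclideanSpace ℝ (Fin (d + 1))) (q : Fin (d + 1)) :
    |z q - w q| ≤ dist z w := by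
  rw [dist_eq_norm]
  simpa using PiLp.norm_apply_le (z - w) q

/-- On the cube the height is at least `1 / (d + 1)`, and `(x i - y i)` times the height at `x` is a
combination of coordinate differences of the two projected points, with coefficients at most one. -/
theorem dist_le_dist_gnomonicChart {x y : Fin d → ℝ} (hx : x ∈ Set.Icc (-1 : Fin d → ℝ) 1)
    (hy : y ∈ Set.Icc (-1 : Fin d → ℝ) 1) :
    dist x y ≤ 2 * (d + 1) * dist (gnomonicChart f x) (gnomonicChart f y) := by
  set D := dist (gnomonicChart f x) (gnomonicChart f y) with hD
  have hD0 : 0 ≤ D := dist_nonneg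
  refine (dist_pi_le_iff (by positivity)).2 fun i => ?_
  have hρx := gnomonicHeight_pos x
  have hlow : 1 ≤ gnomonicHeight x * (d + 1) := by
    rw [gnomonicHeight, ← div_eq_inv_mul, one_le_div (Real.sqrt_pos.2 (one_add_sum_sq_pos x)),
      Real.sqrt_le_left (by positivity)]
    have h : ∑ i, x i ^ 2 ≤ ∑ _i : Fin d, (1 : ℝ) := Finset.sum_le_sum fun i _ =>
      (sq_le_one_iff_abs_le_one _).2 (abs_le.2 ⟨hx.1 i, hx.2 i⟩)
    simp at h
    nlinarith [Nat.cast_nonneg (α := ℝ) d]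
  have h1 : |x i * gnomonicHeight x - y i * gnomonicHeight y| ≤ D := by
    rw [← gnomonicChart_succAbove f, ← gnomonicChart_succAbove f]
    exact abs_apply_le_dist _ _ _
  have h2 : |gnomonicHeight y - gnomonicHeight x| ≤ D := by
    have h := abs_apply_le_dist (gnomonicChart f y) (gnomonicChart f x) f.1
    rwa [gnomonicChart_self, gnomonicChart_self, ← mul_sub, abs_mul, abs_boolSign, one_mul,
      dist_comm] at h
  have h3 : (x i - y i) * gnomonicHeight x =
      (x i * gnomonicHeight x - y i * gnomonicHeight y) +
        y i * (gnomonicHeight y - gnomonicHeight x) := by ring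
  have h4 : |x i - y i| * gnomonicHeight x ≤ 2 * D := by
    rw [← abs_of_pos hρx, ← abs_mul, h3]
    refine (abs_add_le _ _).trans ?_
    rw [abs_mul]
    have : |y i| ≤ 1 := abs_le.2 ⟨hy.1 i, hy.2 i⟩
    nlinarith [abs_nonneg (gnomonicHeight y - gnomonicHeight x)]
  rw [Real.dist_eq]
  calc |x i - y i| ≤ |x i - y i| * (gnomonicHeight x * (d + 1)) :=
        le_mul_of_one_le_right (abs_nonneg _) hlow
    _ = |x i - y i| * gnomonicHeight x * (d + 1) := by ring
    _ ≤ 2 * D * (d + 1) := by gcongr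
    _ = _ := by ring

theorem gnomonicChart_apply_mem (q : Fin (d + 1)) :
    (fun y => gnomonicChart f y q) ∈ sphericalPoly d 1 := by
  rcases Fin.eq_self_or_eq_succAbove f.1 q with rfl | ⟨i, rfl⟩
  · have : (fun y => gnomonicChart f y f.1) = boolSign f.2 • gnomonicHeight := by
      funext y; simp [gnomonicChart_self]
    rw [this]
    exact Submodule.smul_mem _ _ gnomonicHeight_mem
  · simp only [gnomonicChart_succAbove]
    exact coord_mul_gnomonicHeight_mem i

theorem monomialAt_gnomonicChart_mem (w : EuclideanSpace ℝ (Fin (d + 1))) (α : Fin (d + 1) → ℕ)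
    {k : ℕ} (hα : ∑ q, α q ≤ k) :
    (fun y => monomialAt α (gnomonicChart f y - w)) ∈ sphericalPoly d k := by
  refine sphericalPoly_mono hα ?_
  have h : ∀ q, (fun y => gnomonicChart f y q) - w q • (1 : (Fin d → ℝ) → ℝ) ∈
      sphericalPoly d 1 := fun q => Submodule.sub_mem _ (gnomonicChart_apply_mem f q)
    (Submodule.smul_mem _ _ one_mem_sphericalPoly_one)
  convert prod_pow_mem_sphericalPoly Finset.univ _ h α using 1
  funext y
  simp [monomialAt, Finset.prod_apply]

/-- The cube `[-1, 1] ^ d`. -/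
def unitCube (d : ℕ) : Set (Fin d → ℝ) := Set.Icc (-1) 1

/-- The face is selected by a coordinate of largest absolute value; dividing by that value lands in
the cube. -/
theorem exists_gnomonicChart_eq {z : EuclideanSpace ℝ (Fin (d + 1))} (hz : ‖z‖ = 1) :
    ∃ f, ∃ y ∈ unitCube d, gnomonicChart f y = z := by
  obtain ⟨l, hl⟩ := Finite.exists_max fun q => |z q|
  have hl0 : 0 < |z l| := by
    by_contra hcon
    have h0 : z = 0 := by
      ext q
      have := (hl q).trans (not_lt.1 hcon)
      simpa using this
    simp [h0] at hz
  obtain ⟨b, hb⟩ : ∃ b, boolSign b * z l = |z l| := by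
    rcases le_total 0 (z l) with h | h
    · exact ⟨true, by simp [boolSign, abs_of_nonneg h]⟩
    · exact ⟨false, by simp [boolSign, abs_of_nonpos h]⟩
  have hzl : z l = boolSign b * |z l| := by
    rw [← hb, ← mul_assoc, boolSign_mul_self, one_mul]
  set y := gnomonicInv (l, b) z with hy
  have hyi : ∀ i, y i * |z l| = z (l.succAbove i) := by
    intro i
    rw [hy, gnomonicInv]
    simp only [hb]
    exact div_mul_cancel₀ _ hl0.ne'
  have hface : z = |z l| • facePoint (l, b) y := by
    ext q
    rcases Fin.eq_self_or_eq_succAbove l q with rfl | ⟨i, rfl⟩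
    · rw [PiLp.smul_apply, facePoint_self (q, b), smul_eq_mul, mul_comm]
      exact hzl
    · rw [PiLp.smul_apply, facePoint_succAbove (l, b), smul_eq_mul, mul_comm, hyi]
  have hheight : gnomonicHeight y = |z l| := by
    have := congrArg norm hface
    rw [hz, norm_smul, Real.norm_of_nonneg hl0.le] at this
    rw [gnomonicHeight_eq (l, b)]
    exact (eq_inv_of_mul_eq_one_left this.symm).symm
  refine ⟨(l, b), y, ?_, ?_⟩
  · have habs : ∀ i, |y i| ≤ 1 := fun i => by
      have h := hl (l.succAbove i)
      rw [← hyi, abs_mul, abs_abs] at h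
      exact le_of_mul_le_mul_right (by simpa using h) hl0
    exact ⟨fun i => (abs_le.1 (habs i)).1, fun i => (abs_le.1 (habs i)).2⟩
  · rw [gnomonicChart, hheight, ← hface]

theorem abs_gnomonicChart_apply_le {y : Fin d → ℝ} (hy : y ∈ unitCube d) (q : Fin (d + 1)) :
    |gnomonicChart f y q| ≤ gnomonicHeight y := by
  have h := gnomonicHeight_pos y
  rcases Fin.eq_self_or_eq_succAbove f.1 q with rfl | ⟨i, rfl⟩
  · rw [gnomonicChart_self, abs_mul, abs_boolSign, one_mul, abs_of_pos h]
  · rw [gnomonicChart_succAbove, abs_mul, abs_of_pos h]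
    exact mul_le_of_le_one_left h.le (abs_le.2 ⟨hy.1 i, hy.2 i⟩)

/-- Points in two different faces lie on the boundary of these. -/
theorem exists_abs_eq_one_of_gnomonicChart_eq {f f' : Fin (d + 1) × Bool} (hf : f ≠ f')
    {y y' : Fin d → ℝ} (hy : y ∈ unitCube d) (hy' : y' ∈ unitCube d)
    (h : gnomonicChart f y = gnomonicChart f' y') : ∃ i, |y i| = 1 := by
  have hρ := gnomonicHeight_pos y
  have hρ' := gnomonicHeight_pos y'
  have habs : ∀ (g : Fin (d + 1) × Bool) (x : Fin d → ℝ),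
      |gnomonicChart g x g.1| = gnomonicHeight x := fun g x => by
    rw [gnomonicChart_self, abs_mul, abs_boolSign, one_mul, abs_of_pos (gnomonicHeight_pos x)]
  -- Either height is the largest absolute coordinate of the common point.
  have heq : gnomonicHeight y = gnomonicHeight y' := by
    refine le_antisymm ?_ ?_
    · rw [← habs f y, h]; exact abs_gnomonicChart_apply_le f' hy' _
    · rw [← habs f' y', ← h]; exact abs_gnomonicChart_apply_le f hy _
  rcases Fin.eq_self_or_eq_succAbove f.1 f'.1 with h1 | ⟨i, hi⟩
  · exfalso
    have h2 : gnomonicChart f y f.1 = gnomonicChart f' y' f'.1 := by rw [h, h1]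
    rw [gnomonicChart_self, gnomonicChart_self, heq] at h2
    have h3 := mul_right_cancel₀ hρ'.ne' h2
    refine hf (Prod.ext h1.symm ?_)
    revert h3
    cases f.2 <;> cases f'.2 <;> simp [boolSign] <;> norm_num
  · refine ⟨i, ?_⟩
    have h2 := habs f' y'
    rw [← h, hi, gnomonicChart_succAbove, abs_mul, abs_of_pos hρ, ← heq] at h2
    exact mul_right_cancel₀ hρ.ne' (by rw [h2, one_mul])

end chart

/-! ### Area compared with volume in the chart -/

section area

variable {d : ℕ} (f : Fin (d + 1) × Bool)

/-- The density of `d`-dimensional area with respect to the `d`-dimensional Hausdorff measure. -/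
def areaFactor (d : ℕ) : NNReal :=
  Measure.addHaarScalarFactor (volume : Measure (EuclideanSpace ℝ (Fin d))) μH[d]

theorem areaFactor_pos (d : ℕ) : 0 < areaFactor d :=
  pos_iff_ne_zero.2 (Measure.addHaarScalarFactor_volume_hausdorffMeasure_ne_zero d)

theorem areaMeasure_apply (s : Set (EuclideanSpace ℝ (Fin (d + 1)))) :
    areaMeasure d s = areaFactor d * μH[d] s := rfl

theorem hausdorffMeasure_pi_fin : (μH[d] : Measure (Fin d → ℝ)) = volume := by
  have := hausdorffMeasure_pi_real (ι := Fin d)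
  rwa [Fintype.card_fin] at this

/-- A `K`-Lipschitz map enlarges `d`-dimensional Hausdorff measure by at most `K ^ d`, and for the
sup metric on `Fin d → ℝ` this measure is Lebesgue measure. -/
theorem areaMeasure_image_le (s : Set (Fin d → ℝ)) :
    areaMeasure d (gnomonicChart f '' s) ≤ (areaFactor d * (2 * d) ^ d : NNReal) * volume s := by
  have hlip : LipschitzWith (2 * d) (gnomonicChart f) :=
    LipschitzWith.of_dist_le_mul fun x y => by simpa using dist_gnomonicChart_le f x y
  have h := hlip.lipschitzOnWith (s := s) |>.hausdorffMeasure_image_le (Nat.cast_nonneg d)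
  rw [hausdorffMeasure_pi_fin, ENNReal.rpow_natCast] at h
  rw [areaMeasure_apply, ENNReal.coe_mul, mul_assoc, ENNReal.coe_pow]
  gcongr

theorem volume_le_areaMeasure_image {s : Set (Fin d → ℝ)} (hs : s ⊆ unitCube d) :
    areaFactor d * volume s ≤
      ((2 * (d + 1)) ^ d : NNReal) * areaMeasure d (gnomonicChart f '' s) := by
  have hlip : LipschitzOnWith (2 * (d + 1)) (gnomonicInv f) (gnomonicChart f '' s) := by
    refine LipschitzOnWith.of_dist_le_mul ?_
    rintro _ ⟨x, hx, rfl⟩ _ ⟨y, hy, rfl⟩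
    rw [gnomonicInv_gnomonicChart, gnomonicInv_gnomonicChart]
    simpa using dist_le_dist_gnomonicChart f (hs hx) (hs hy)
  have h := hlip.hausdorffMeasure_image_le (Nat.cast_nonneg d)
  rw [hausdorffMeasure_pi_fin, ENNReal.rpow_natCast, Set.image_image] at h
  simp only [gnomonicInv_gnomonicChart, Set.image_id'] at h
  rw [areaMeasure_apply, mul_left_comm, ENNReal.coe_pow]
  gcongr

/-- Area on a face, as a measure on the gnomonic chart. -/
def chartMeasure : Measure (Fin d → ℝ) :=
  ((areaMeasure d).restrict (gnomonicChart f '' unitCube d)).map (gnomonicInv f)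

theorem isCompact_unitCube : IsCompact (unitCube d) := isCompact_Icc

theorem measurableSet_image_unitCube : MeasurableSet (gnomonicChart f '' unitCube d) :=
  (isCompact_unitCube.image (continuous_gnomonicChart f)).measurableSet

theorem preimage_inter_image_unitCube (s : Set (Fin d → ℝ)) :
    gnomonicInv f ⁻¹' s ∩ gnomonicChart f '' unitCube d = gnomonicChart f '' (s ∩ unitCube d) := by
  ext z
  constructor
  · rintro ⟨h, y, hy, rfl⟩
    rw [Set.mem_preimage, gnomonicInv_gnomonicChart] at h
    exact ⟨y, ⟨h, hy⟩, rfl⟩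
  · rintro ⟨y, ⟨h, hy⟩, rfl⟩
    exact ⟨by rwa [Set.mem_preimage, gnomonicInv_gnomonicChart], y, hy, rfl⟩

theorem chartMeasure_apply {s : Set (Fin d → ℝ)} (hs : MeasurableSet s) :
    chartMeasure f s = areaMeasure d (gnomonicChart f '' (s ∩ unitCube d)) := by
  rw [chartMeasure, Measure.map_apply (measurable_gnomonicInv f) hs,
    Measure.restrict_apply (measurable_gnomonicInv f hs), preimage_inter_image_unitCube]

theorem setIntegral_image_gnomonicChart {s : Set (Fin d → ℝ)} (hs : MeasurableSet s)
    (hsc : s ⊆ unitCube d) {F : EuclideanSpace ℝ (Fin (d + 1)) → ℝ} (hF : Continuous F) :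
    ∫ z in gnomonicChart f '' s, F z ∂(areaMeasure d) =
      ∫ y in s, F (gnomonicChart f y) ∂(chartMeasure f) := by
  have hFm : AEStronglyMeasurable (fun y => F (gnomonicChart f y)) (chartMeasure f) :=
    (hF.comp (continuous_gnomonicChart f)).aestronglyMeasurable
  have himg : gnomonicInv f ⁻¹' s ∩ gnomonicChart f '' unitCube d = gnomonicChart f '' s := by
    rw [preimage_inter_image_unitCube, Set.inter_eq_left.2 hsc]
  have hmeas : MeasurableSet (gnomonicChart f '' s) := by
    rw [← himg]
    exact (measurable_gnomonicInv f hs).inter (measurableSet_image_unitCube f)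
  rw [chartMeasure, setIntegral_map hs hFm (measurable_gnomonicInv f).aemeasurable,
    Measure.restrict_restrict (measurable_gnomonicInv f hs), himg]
  refine setIntegral_congr_fun hmeas ?_
  rintro _ ⟨y, -, rfl⟩
  simp only [gnomonicInv_gnomonicChart]

theorem volume_unitCube_lt_top : volume (unitCube d) < ⊤ := isCompact_unitCube.measure_lt_top

theorem volume_coord_hyperplane (i : Fin d) (t : ℝ) : volume {y : Fin d → ℝ | y i = t} = 0 := by
  rw [volume_pi]
  exact Measure.pi_hyperplane (α := fun _ => ℝ) _ i t

/-- Lipschitz bounds for the chart and its inverse replace any Jacobian computation; hyperplanes are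
null because their volume is zero. -/
theorem boxComparable_chartMeasure :
    BoxComparable (chartMeasure f) (unitCube d) (areaFactor d / (2 * (d + 1)) ^ d)
      (areaFactor d * (2 * d) ^ d) := by
  have hbox : ∀ u v : Fin d → ℝ, Set.Icc u v ⊆ unitCube d →
      chartMeasure f (Set.Icc u v) = areaMeasure d (gnomonicChart f '' Set.Icc u v) := by
    intro u v h
    rw [chartMeasure_apply f measurableSet_Icc, Set.inter_eq_left.2 h]
  have hfin : chartMeasure f Set.univ < ⊤ := by
    rw [chartMeasure_apply f MeasurableSet.univ]
    refine (areaMeasure_image_le f _).trans_lt (ENNReal.mul_lt_top ENNReal.coe_lt_top ?_)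
    exact (measure_mono Set.inter_subset_right).trans_lt volume_unitCube_lt_top
  refine ⟨div_pos (areaFactor_pos d) (by positivity), hfin, fun l t => ?_, fun u v huv h => ?_,
    fun u v huv h => ?_⟩
  · have hm : MeasurableSet {y : Fin d → ℝ | y l = t} :=
      measurableSet_eq_fun (measurable_pi_apply l) measurable_const
    rw [chartMeasure_apply f hm, ← nonpos_iff_eq_zero]
    refine (areaMeasure_image_le f _).trans ?_
    have h0 : volume ({y : Fin d → ℝ | y l = t} ∩ unitCube d) = 0 :=
      measure_mono_null Set.inter_subset_left (volume_coord_hyperplane l t)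
    rw [h0, mul_zero]
  · have h1 := volume_le_areaMeasure_image f h
    rw [← hbox u v h] at h1
    have h2 := ENNReal.toReal_mono (ENNReal.mul_ne_top ENNReal.coe_ne_top
      ((measure_mono (Set.subset_univ _)).trans_lt hfin).ne) h1
    rw [ENNReal.toReal_mul, ENNReal.toReal_mul, Real.volume_Icc_pi_toReal huv,
      ENNReal.coe_toReal, ENNReal.coe_toReal] at h2
    rw [div_mul_eq_mul_div, div_le_iff₀ (by positivity), mul_comm ((chartMeasure f).real _)]
    simpa [Measure.real] using h2
  · have h1 := areaMeasure_image_le f (Set.Icc u v)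
    rw [← hbox u v h] at h1
    have h2 := ENNReal.toReal_mono (ENNReal.mul_ne_top ENNReal.coe_ne_top
      (isCompact_Icc.measure_lt_top).ne) h1
    rw [ENNReal.toReal_mul, Real.volume_Icc_pi_toReal huv] at h2
    simpa [Measure.real] using h2

end area

/-! ### The cells of the sphere and their quadratures -/

section grid

variable {d : ℕ}

/-- The lower corner of a cell of the partition of `[-1, 1] ^ d` into `q ^ d` cubes. -/
def gridCorner (q : ℕ) (m : Fin d → Fin q) : Fin d → ℝ := fun i => -1 + 2 / q * (m i : ℕ)

/-- A cell of the partition of `[-1, 1] ^ d` into `q ^ d` cubes. -/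
def gridCell (q : ℕ) (m : Fin d → Fin q) : Set (Fin d → ℝ) :=
  Set.Icc (gridCorner q m) fun i => gridCorner q m i + 2 / q

theorem gridCell_subset {q : ℕ} (hq : 0 < q) (m : Fin d → Fin q) : gridCell q m ⊆ unitCube d := by
  have hq' : (0 : ℝ) < q := by exact_mod_cast hq
  intro y hy
  refine ⟨fun i => ?_, fun i => ?_⟩
  · have h := hy.1 i
    have : 0 ≤ 2 / (q : ℝ) * (m i : ℕ) := by positivity
    simp only [gridCorner] at h
    simp only [Pi.neg_apply, Pi.one_apply]
    linarith
  · have h := hy.2 i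
    have h1 : ((m i : ℕ) : ℝ) + 1 ≤ q := by exact_mod_cast (m i).2
    have h2 : 2 / (q : ℝ) * ((m i : ℕ) + 1) ≤ 2 := by
      rw [div_mul_eq_mul_div, div_le_iff₀ hq']; linarith
    simp only [gridCorner] at h
    simp only [Pi.one_apply]
    linarith

theorem exists_mem_gridCell {q : ℕ} (hq : 0 < q) {y : Fin d → ℝ} (hy : y ∈ unitCube d) :
    ∃ m, y ∈ gridCell q m := by
  have hq' : (0 : ℝ) < q := by exact_mod_cast hq
  have h : ∀ i, ∃ m : Fin q, -1 + 2 / q * (m : ℕ) ≤ y i ∧ y i ≤ -1 + 2 / q * (m : ℕ) + 2 / q := by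
    intro i
    have h1 : -1 ≤ y i := hy.1 i
    have h2 : y i ≤ 1 := hy.2 i
    set t := (y i + 1) * q / 2 with ht
    have ht0 : 0 ≤ t := by
      have : 0 ≤ y i + 1 := by linarith
      positivity
    have hyt : y i = -1 + 2 / q * t := by rw [ht]; field_simp; ring
    have htq : t ≤ q := by rw [ht]; nlinarith
    -- The floor of `t` serves except at the right end `t = q`, which is assigned to the last cell.
    obtain ⟨m, hm1, hm2⟩ : ∃ m : Fin q, ((m : ℕ) : ℝ) ≤ t ∧ t ≤ (m : ℕ) + 1 := by
      rcases lt_or_ge ⌊t⌋₊ q with h | h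
      · exact ⟨⟨⌊t⌋₊, h⟩, Nat.floor_le ht0, (Nat.lt_floor_add_one t).le⟩
      · have h3 : (q : ℝ) ≤ t := (Nat.cast_le.2 h).trans (Nat.floor_le ht0)
        refine ⟨⟨q - 1, by omega⟩, ?_, ?_⟩ <;> simp only [Nat.cast_sub hq] <;> push_cast <;>
          linarith
    refine ⟨m, ?_, ?_⟩
    · rw [hyt]; gcongr
    · rw [hyt]
      have : 2 / (q : ℝ) * t ≤ 2 / q * ((m : ℕ) + 1) := by gcongr
      linarith
  choose m hm using h
  exact ⟨m, fun i => (hm i).1, fun i => (hm i).2⟩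

/-- The hyperplanes that separate the cells of the grid. -/
def gridWalls (d q : ℕ) : Set (Fin d → ℝ) :=
  ⋃ (i : Fin d) (j : Fin (q + 1)), {y | y i = -1 + 2 / q * (j : ℕ)}

theorem volume_gridWalls (q : ℕ) : volume (gridWalls d q) = 0 :=
  measure_iUnion_null fun i => measure_iUnion_null fun _ => volume_coord_hyperplane i _

theorem mem_gridWalls_of_mem_gridCell {q : ℕ} {m m' : Fin d → Fin q} (hm : m ≠ m')
    {y : Fin d → ℝ} (hy : y ∈ gridCell q m) (hy' : y ∈ gridCell q m') : y ∈ gridWalls d q := by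
  obtain ⟨i, hi⟩ := Function.ne_iff.1 hm
  have key : ∀ a b : Fin q, a < b → y i ≤ -1 + 2 / q * (a : ℕ) + 2 / q →
      -1 + 2 / q * (b : ℕ) ≤ y i → y ∈ gridWalls d q := by
    intro a b hab h1 h2
    refine Set.mem_iUnion₂.2 ⟨i, b.castSucc, le_antisymm (h1.trans ?_) h2⟩
    have h3 : ((a : ℕ) : ℝ) + 1 ≤ (b : ℕ) := by exact_mod_cast hab
    have h4 : 2 / (q : ℝ) * ((a : ℕ) + 1) ≤ 2 / q * (b : ℕ) := by gcongr
    simp only [Fin.val_castSucc]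
    linarith
  rcases lt_or_gt_of_ne hi with h | h
  · exact key _ _ h (hy.2 i) (hy'.1 i)
  · exact key _ _ h (hy'.2 i) (hy.1 i)

theorem mem_gridWalls_of_abs_eq_one {q : ℕ} (hq : 0 < q) {y : Fin d → ℝ} {i : Fin d}
    (h : |y i| = 1) : y ∈ gridWalls d q := by
  have hq' : (q : ℝ) ≠ 0 := by exact_mod_cast hq.ne'
  rcases (abs_eq zero_le_one).1 h with h | h
  · refine Set.mem_iUnion₂.2 ⟨i, Fin.last q, ?_⟩
    simp only [Set.mem_ofPred_eq, Fin.val_last, h]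
    field_simp
    norm_num
  · exact Set.mem_iUnion₂.2 ⟨i, 0, by simp [h]⟩

/-- The part of the sphere over a cell of the grid in a face of the cube. -/
def sphereCell (q : ℕ) (p : (Fin (d + 1) × Bool) × (Fin d → Fin q)) :
    Set (EuclideanSpace ℝ (Fin (d + 1))) :=
  gnomonicChart p.1 '' gridCell q p.2

/-- Cells of one face meet over grid walls. Cells of different faces meet over the boundary of the
cube, which consists of walls too. -/
theorem areaMeasure_sphereCell_inter {q : ℕ} (hq : 0 < q)
    {p p' : (Fin (d + 1) × Bool) × (Fin d → Fin q)} (hp : p ≠ p') :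
    areaMeasure d (sphereCell q p ∩ sphereCell q p') = 0 := by
  have hsub : sphereCell q p ∩ sphereCell q p' ⊆ gnomonicChart p.1 '' gridWalls d q := by
    rintro _ ⟨⟨y, hy, rfl⟩, y', hy', h⟩
    refine ⟨y, ?_, rfl⟩
    by_cases hf : p.1 = p'.1
    · have hyy : y' = y := by
        have := congrArg (gnomonicInv p.1) h
        rw [← hf] at this
        rwa [gnomonicInv_gnomonicChart, gnomonicInv_gnomonicChart] at this
      rw [hyy] at hy'
      exact mem_gridWalls_of_mem_gridCell (fun h2 => hp (Prod.ext hf h2)) hy hy'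
    · obtain ⟨i, hi⟩ := exists_abs_eq_one_of_gnomonicChart_eq hf (gridCell_subset hq _ hy)
        (gridCell_subset hq _ hy') h.symm
      exact mem_gridWalls_of_abs_eq_one hq hi
  refine measure_mono_null hsub (nonpos_iff_eq_zero.1 ((areaMeasure_image_le _ _).trans ?_))
  rw [volume_gridWalls, mul_zero]

theorem iUnion_sphereCell {q : ℕ} (hq : 0 < q) : unitSphere d ⊆ ⋃ p, sphereCell q p := by
  intro z hz
  obtain ⟨f, y, hy, rfl⟩ := exists_gnomonicChart_eq (mem_sphere_zero_iff_norm.1 hz)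
  obtain ⟨m, hm⟩ := exists_mem_gridCell hq hy
  exact Set.mem_iUnion.2 ⟨(f, m), y, hm, rfl⟩

theorem diam_sphereCell_le (q : ℕ) (p : (Fin (d + 1) × Bool) × (Fin d → Fin q)) :
    Metric.diam (sphereCell q p) ≤ 2 * d * (2 / q) := by
  refine Metric.diam_le_of_forall_dist_le (by positivity) ?_
  rintro _ ⟨x, hx, rfl⟩ _ ⟨y, hy, rfl⟩
  refine (dist_gnomonicChart_le _ _ _).trans ?_
  gcongr
  refine (dist_pi_le_iff (by positivity)).2 fun i => ?_
  rw [Real.dist_eq, abs_le]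
  have h1 := hx.1 i
  have h2 := hx.2 i
  have h3 := hy.1 i
  have h4 := hy.2 i
  simp only at h2 h4
  constructor <;> linarith

theorem areaMeasure_sphereCell {q : ℕ} (hq : 0 < q)
    (p : (Fin (d + 1) × Bool) × (Fin d → Fin q)) :
    areaMeasure d (sphereCell q p) = chartMeasure p.1 (gridCell q p.2) := by
  rw [chartMeasure_apply _ (show MeasurableSet (gridCell q p.2) from measurableSet_Icc),
    Set.inter_eq_left.2 (gridCell_subset hq _),
    sphereCell]

theorem measurableSet_sphereCell (q : ℕ) (p : (Fin (d + 1) × Bool) × (Fin d → Fin q)) :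
    MeasurableSet (sphereCell q p) :=
  (isCompact_Icc.image (continuous_gnomonicChart p.1)).measurableSet

theorem continuous_monomialAt (α : Fin (d + 1) → ℕ) (w : EuclideanSpace ℝ (Fin (d + 1))) :
    Continuous fun z => monomialAt α (z - w) := by
  refine continuous_finsetProd _ fun q _ => Continuous.pow ?_ _
  exact (EuclideanSpace.proj (𝕜 := ℝ) q).continuous.comp (continuous_id.sub continuous_const)

/-- The ratio of the two constants that compare area and volume in the gnomonic chart. -/
def distortion (d : ℕ) : ℝ :=
  areaFactor d * (2 * d) ^ d / (areaFactor d / (2 * (d + 1)) ^ d)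

/-- The base of the exponential number of nodes of the quadratures. -/
def nodeBase (d : ℕ) : ℝ :=
  16 * distortion d ^ 5 * d ^ 2 * (2 * d) ^ d * (1000 * d) ^ (3 * (d + 1))

theorem one_le_distortion (hd : 1 ≤ d) : 1 ≤ distortion d := by
  have hd' : (1 : ℝ) ≤ d := by exact_mod_cast hd
  have hA : (0 : ℝ) < areaFactor d := areaFactor_pos d
  rw [distortion, one_le_div (by positivity)]
  calc (areaFactor d : ℝ) / (2 * (d + 1)) ^ d ≤ areaFactor d := by
        refine div_le_self hA.le (one_le_pow₀ (by linarith))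
    _ ≤ _ := le_mul_of_one_le_right hA.le (one_le_pow₀ (by linarith))

theorem one_le_nodeBase (hd : 1 ≤ d) : 1 ≤ nodeBase d := by
  have hd' : (1 : ℝ) ≤ d := by exact_mod_cast hd
  have h1 := one_le_pow₀ (one_le_distortion hd) (n := 5)
  have h2 : (1 : ℝ) ≤ d ^ 2 := one_le_pow₀ hd'
  have h3 : (1 : ℝ) ≤ (2 * d) ^ d := one_le_pow₀ (by linarith)
  have h4 : (1 : ℝ) ≤ (1000 * d) ^ (3 * (d + 1)) := one_le_pow₀ (by linarith)
  rw [nodeBase]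
  exact one_le_mul_of_one_le_of_one_le (one_le_mul_of_one_le_of_one_le
    (one_le_mul_of_one_le_of_one_le (by linarith) h2) h3) h4

/-- Equal weight quadratures on the cells of the sphere that are exact for all polynomials of degree
at most `k`. -/
theorem exists_exact_quadrature_sphereCell (hd : 1 ≤ d) {q : ℕ} (hq : 0 < q)
    (p : (Fin (d + 1) × Bool) × (Fin d → Fin q)) {k : ℕ} (hk : 1 ≤ k) {n : ℕ}
    (hn : nodeBase d ^ k ≤ n) :
    ∃ z : Fin (n ^ d) → EuclideanSpace ℝ (Fin (d + 1)), (∀ j, z j ∈ sphereCell q p) ∧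
      ∀ (w : EuclideanSpace ℝ (Fin (d + 1))) (α : Fin (d + 1) → ℕ), ∑ i, α i ≤ k →
        (∑ j, monomialAt α (z j - w)) / ((n ^ d : ℕ) : ℝ) =
          (∫ x in sphereCell q p, monomialAt α (x - w) ∂(areaMeasure d)) /
            (areaMeasure d).real (sphereCell q p) := by
  have hd' : (1 : ℝ) ≤ d := by exact_mod_cast hd
  have hq' : (0 : ℝ) < q := by exact_mod_cast hq
  have hsub := gridCell_subset hq p.2
  -- The exponent is `k + 2` because the Markov inequality is applied to first derivatives.
  set A : ℝ := (1000 * d) ^ (k + 2) with hA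
  have hA1 : 1 ≤ A := one_le_pow₀ (by linarith)
  have hdist := one_le_distortion hd
  have hbound : 16 * distortion d ^ 5 * d ^ 2 * A * (2 * d * A) ^ d ≤ n := by
    refine le_trans ?_ hn
    set B := 16 * distortion d ^ 5 * d ^ 2 * (2 * d) ^ d with hB
    have hB1 : 1 ≤ B := by
      have h1 := one_le_pow₀ hdist (n := 5)
      have h2 : (1 : ℝ) ≤ d ^ 2 := one_le_pow₀ hd'
      have h3 : (1 : ℝ) ≤ (2 * d) ^ d := one_le_pow₀ (by linarith)
      exact one_le_mul_of_one_le_of_one_le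
        (one_le_mul_of_one_le_of_one_le (by linarith) h2) h3
    -- Here `k + 2 ≤ 3 * k`, as `1 ≤ k`, makes the bound purely exponential in `k`.
    have hA2 : A ^ (d + 1) ≤ ((1000 * d) ^ (3 * (d + 1))) ^ k := by
      rw [hA, ← pow_mul, ← pow_mul]
      refine pow_le_pow_right₀ (by linarith) ?_
      calc (k + 2) * (d + 1) ≤ (3 * k) * (d + 1) := Nat.mul_le_mul_right _ (by omega)
        _ = _ := by ring
    calc 16 * distortion d ^ 5 * d ^ 2 * A * (2 * d * A) ^ d = B * A ^ (d + 1) := by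
          rw [hB, mul_pow, pow_succ]; ring
      _ ≤ B ^ k * ((1000 * d) ^ (3 * (d + 1))) ^ k := by
          gcongr
          exact le_self_pow₀ hB1 (by omega)
      _ = nodeBase d ^ k := by rw [← mul_pow, nodeBase]
  obtain ⟨y, hy, hyW⟩ := exists_equal_weight_quadrature (c := areaFactor d / (2 * (d + 1)) ^ d)
    (C := areaFactor d * (2 * d) ^ d) (r := 2 / q) hd (by positivity)
    ((boxComparable_chartMeasure p.1).mono hsub) (sphericalPoly d k) (sphericalPoly_fg k)
    (fun g hg => (differentiable_and_partialDeriv_mem hg).1)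
    (fun g hg j => (differentiable_and_partialDeriv_mem
      ((differentiable_and_partialDeriv_mem hg).2 j)).1) hA1
    (fun g hg j G hG i x hx => abs_partialDeriv_le (by omega)
      ((differentiable_and_partialDeriv_mem hg).2 j) (by positivity) hsub hG i hx) hbound
  refine ⟨fun j => gnomonicChart p.1 (y j), fun j => ⟨y j, hy j, rfl⟩, fun w α hα => ?_⟩
  have h := hyW _ (monomialAt_gnomonicChart_mem p.1 w α hα)
  have hint := setIntegral_image_gnomonicChart p.1 measurableSet_Icc hsub
    (continuous_monomialAt α w)
  rw [h, Measure.real, Measure.real, areaMeasure_sphereCell hq]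
  congr 1
  exact hint.symm

end grid

/-! ### Conclusion -/

/-- The bound defining `mZero` is less than one, so the base of the power is too: `k * e < m + 1`,
which is more than enough. -/
theorem le_mZero {d k : ℕ} {δ : ℝ} (hd : 1 ≤ d) (hk : 1 ≤ k) (hδ : 0 < δ) (hδ1 : δ < 1) :
    k ≤ mZero d k δ := by
  obtain ⟨⟨-, hm⟩, -⟩ := mZero_isLeast d k δ hd hδ
  set m := mZero d k δ
  have hd' : (1 : ℝ) ≤ d := by exact_mod_cast hd
  have hk' : (1 : ℝ) ≤ k := by exact_mod_cast hk
  have hlt : δ / (2 * (d : ℝ) * 2 ^ k) < 1 := by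
    rw [div_lt_one (by positivity)]
    have : (1 : ℝ) ≤ 2 ^ k := one_le_pow₀ (by norm_num)
    nlinarith
  have hbase : (k : ℝ) * Real.exp 1 / ((m : ℝ) + 1) < 1 := by
    by_contra hcon
    exact absurd (hm.trans_lt hlt) (not_lt.2 (one_le_pow₀ (not_lt.1 hcon)))
  rw [div_lt_one (by positivity)] at hbase
  have he : 2 < Real.exp 1 := by linarith [Real.exp_one_gt_d9]
  have : (k : ℝ) < m + 1 := by nlinarith
  have : k < m + 1 := by exact_mod_cast this
  omega

end

theorem theorem1p13 (d : ℕ) (hd : 1 ≤ d) :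
    ∃ C c : ℝ, 0 < C ∧ 0 < c ∧ ∀ τ : ℝ, 0 < τ → τ < 1 →
      ∃ K : ℕ, 0 < K ∧ ∀ (k : ℕ) (δ : ℝ), 1 ≤ k → 0 < δ → δ < 1 →
        ∃ E : Fin K → Set (EuclideanSpace ℝ (Fin (d + 1))),
          (∀ i, MeasurableSet (E i)) ∧
          (∀ i, E i ⊆ unitSphere d) ∧
          (∀ i j, i ≠ j → areaMeasure d (E i ∩ E j) = 0) ∧
          areaMeasure d (unitSphere d \ ⋃ i, E i) = 0 ∧
          (∀ i, Metric.diam (E i) ≤ C * τ) ∧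
          (∀ i, areaMeasure d (E i) ≠ ⊤ ∧ c * τ ^ d ≤ (areaMeasure d).real (E i)) ∧
          (K : ℝ) ≤ C * (τ ^ d)⁻¹ ∧
          ∀ n : ℕ, C ^ mZero d k δ ≤ (n : ℝ) → ∀ i,
            ∃ z : Fin (n ^ d) → EuclideanSpace ℝ (Fin (d + 1)),
              (∀ j, z j ∈ E i) ∧
              ∀ w ∈ unitSphere d, ∀ α : Fin (d + 1) → ℕ, ∑ q, α q ≤ k →
                |(∑ j, monomialAt α (z j - w)) / ((n ^ d : ℕ) : ℝ) -
                  (∫ x in E i, monomialAt α (x - w) ∂(areaMeasure d)) /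
                    (areaMeasure d).real (E i)| ≤ δ := by
  have hd' : (1 : ℝ) ≤ d := by exact_mod_cast hd
  have hbase := one_le_nodeBase hd
  set c : ℝ := areaFactor d / (2 * (d + 1)) ^ d with hc
  have hc0 : 0 < c := div_pos (areaFactor_pos d) (by positivity)
  -- The summands serve the diameters, the number of cells and the number of nodes, respectively.
  set C : ℝ := 4 * d + 2 * (d + 1) * 2 ^ d + nodeBase d with hC
  have hpow : (0 : ℝ) < 2 * (d + 1) * 2 ^ d := by positivity
  refine ⟨C, c, by positivity, hc0, fun τ hτ hτ1 => ?_⟩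
  -- the grid has mesh between `τ` and `2 * τ`
  set q := ⌈τ⁻¹⌉₊ with hqdef
  have hq : 0 < q := Nat.ceil_pos.2 (inv_pos.2 hτ)
  have hq' : (0 : ℝ) < q := by exact_mod_cast hq
  have hqlow : τ⁻¹ ≤ q := Nat.le_ceil _
  have hqupp : (q : ℝ) ≤ 2 * τ⁻¹ := by
    have h1 := (Nat.ceil_lt_add_one (inv_pos.2 hτ).le).le
    have h2 := (one_le_inv₀ hτ).2 hτ1.le
    linarith
  have hmesh_le : 2 / (q : ℝ) ≤ 2 * τ := by
    rw [div_le_iff₀ hq']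
    have := mul_le_mul_of_nonneg_left hqlow hτ.le
    rw [mul_inv_cancel₀ hτ.ne'] at this
    linarith
  have hle_mesh : τ ≤ 2 / (q : ℝ) := by
    rw [le_div_iff₀ hq']
    calc τ * q ≤ τ * (2 * τ⁻¹) := by gcongr
      _ = 2 := by field_simp
  set ι := (Fin (d + 1) × Bool) × (Fin d → Fin q) with hι
  have hcard : Fintype.card ι = (d + 1) * 2 * q ^ d := by simp [hι]
  have e : Fin (Fintype.card ι) ≃ ι := (Fintype.equivFin ι).symm
  refine ⟨Fintype.card ι, by rw [hcard]; positivity, fun k δ hk hδ hδ1 => ?_⟩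
  refine ⟨fun i => sphereCell q (e i), fun i => measurableSet_sphereCell q _, fun i => ?_,
    fun i j hij => areaMeasure_sphereCell_inter hq (e.injective.ne hij), ?_, fun i => ?_,
    fun i => ⟨?_, ?_⟩, ?_, fun n hn i => ?_⟩
  · rintro _ ⟨y, -, rfl⟩
    exact mem_sphere_zero_iff_norm.2 (norm_gnomonicChart _ y)
  · rw [e.surjective.iUnion_comp, Set.sdiff_eq_empty.2 (iUnion_sphereCell hq), measure_empty]
  · calc Metric.diam (sphereCell q (e i)) ≤ 2 * d * (2 / q) := diam_sphereCell_le q _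
      _ ≤ 2 * d * (2 * τ) := by gcongr
      _ = 4 * d * τ := by ring
      _ ≤ C * τ := by gcongr; linarith
  · rw [areaMeasure_sphereCell hq]
    exact ((measure_mono (Set.subset_univ _)).trans_lt (boxComparable_chartMeasure _).finite).ne
  · have h := (boxComparable_chartMeasure (e i).1).lower (gridCorner q (e i).2)
      (fun l => gridCorner q (e i).2 l + 2 / q) (fun l => by simp only; linarith)
      (gridCell_subset hq _)
    simp only [add_sub_cancel_left, Finset.prod_const, Finset.card_univ, Fintype.card_fin] at h
    rw [Measure.real, areaMeasure_sphereCell hq]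
    calc c * τ ^ d ≤ c * (2 / q) ^ d := by gcongr
      _ ≤ _ := h
  · rw [hcard]
    push_cast
    calc ((d : ℝ) + 1) * 2 * q ^ d ≤ (d + 1) * 2 * (2 * τ⁻¹) ^ d := by gcongr
      _ = 2 * (d + 1) * 2 ^ d * (τ ^ d)⁻¹ := by rw [mul_pow, inv_pow]; ring
      _ ≤ C * (τ ^ d)⁻¹ := by gcongr; linarith
  · have hBC : nodeBase d ≤ C := by linarith
    have hn' : nodeBase d ^ k ≤ n := by
      calc nodeBase d ^ k ≤ nodeBase d ^ mZero d k δ :=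
            pow_le_pow_right₀ hbase (le_mZero hd hk hδ hδ1)
        _ ≤ C ^ mZero d k δ := by gcongr
        _ ≤ n := hn
    obtain ⟨z, hz, hzα⟩ := exists_exact_quadrature_sphereCell hd hq (e i) hk hn'
    refine ⟨z, hz, fun w _ α hα => ?_⟩
    -- The quadrature is exact, so the error is zero rather than merely at most `δ`.
    rw [hzα w α hα, sub_self, abs_zero]
    exact hδ.le
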